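/- Let $d(n)$ be the number of positive divisors of $n$, let $\gamma$ be Euler's constant, let $\psi(u)=u-[u]-\tfrac12$, where $[u]$ is the greatest integer not exceeding $u$, and for real $x\ge 1$ let $$\Delta(1,1;x)=\sum_{1\le n\le x}d(n)-\bigl(x\log x+(2\gamma-1)x\bigr)$$ be the error term in the Dirichlet divisor problem. Then for all real $x\ge 2$ $$\sum_{1\le n\le x}\Delta^2(1,1;n)=\Bigl(\tfrac12-\psi(x)\Bigr)\Delta^2(1,1;x)+\int_1^x\Delta^2(1,1;t)\,dt+\tfrac16x\log^2x+\tfrac{8\gamma-1}{12}x\log x+\tfrac{8\gamma^2-2\gamma+1}{12}x+(\log x+2\gamma)G_{(1,1)}(x)+O(\sqrt x\log x),$$ where $$G_{(1,1)}(x)=\frac{1}{2\sqrt2\,\pi^2}\,x^{3/4}\sum_{n=1}^\infty\frac{d(n)}{n^{5/4}}\sin\Bigl(4\pi\sqrt{nx}-\frac{\pi}{4}\Bigr),$$ the series being absolutely convergent, $\Delta^2(1,1;t)$ is integrable on $[1,x]$, and the constant implied by $O$ is absolute. -/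

import Mathlib

namespace DivisorMeanSquare

/-- The divisor function `d(n) = d(1,1;n)`, the number of ordered pairs `(h, r)` of positive
integers with `h * r = n`, i.e. the number of positive divisors of `n` (and `d 0 = 0`). -/
def d (n : ℕ) : ℕ := n.divisors.card

/-- The summatory function `D(1,1;x)`, the sum of `d n` over positive integers `n ≤ x`. -/
noncomputable def D (x : ℝ) : ℕ := ∑ n ∈ Finset.Icc 1 ⌊x⌋₊, d n

/-- The error term in the Dirichlet divisor problem,
`Δ(1,1;x) = D(1,1;x) - (x log x + (2γ - 1) x)`, where `γ` is Euler's constant. -/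
noncomputable def Delta (x : ℝ) : ℝ :=
  (D x : ℝ) - (x * Real.log x + (2 * Real.eulerMascheroniConstant - 1) * x)

/-- The sawtooth function `ψ(u) = u - [u] - 1/2`. -/
noncomputable def psi (u : ℝ) : ℝ := u - (⌊u⌋ : ℝ) - 1 / 2

/-- The `n`-th term `d(n) n^{-5/4} sin(4π√(nx) - π/4)` of the series in `G_{(1,1)}(x)`.
It vanishes for `n = 0` because `d 0 = 0`. -/
noncomputable def GTerm (x : ℝ) (n : ℕ) : ℝ :=
  (d n : ℝ) / (n : ℝ) ^ (5 / 4 : ℝ) *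
    Real.sin (4 * Real.pi * Real.sqrt ((n : ℝ) * x) - Real.pi / 4)

/-- The function `G_{(1,1)}(x)`. -/
noncomputable def G (x : ℝ) : ℝ :=
  1 / (2 * Real.sqrt 2 * Real.pi ^ 2) * x ^ (3 / 4 : ℝ) * ∑' n : ℕ, GTerm x n

end DivisorMeanSquare

/-! Write `Delta = D - mainTerm`, where `D` is constant between integers and `mainTerm` has
derivative `mainDeriv t = log t + 2γ`. On each unit interval, differentiating (t - n - 1) Δ(t)² and
adding up gives an exact identity (`sum_Delta_sq_eq`): the sum of Δ(n)² equals (1/2 - ψ(x)) Δ(x)² +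
∫ Δ² + ∫ Δ (log t + 2γ) - 2 ∫ ψ Δ (log t + 2γ). It remains to evaluate the last two integrals up to
O(√x log x).

The sawtooth integral is elementary once Δ(x) = O(√x) is known. A primitive of ψ is -`fractQuad`,
which vanishes at integers, so integration by parts does not see the jumps of Δ. What survives is -∫
`fractQuad` (log t + 2γ)², and `fractQuad` has mean 1/12; this gives a contribution (1/6) ∫ (log t +
2γ)² to the sum.

The other integral requires the Voronoi-type formula ∫_1^x Δ = x/4 + G(x) + O(√x)
(`exists_abs_integral_Delta_sub_le`). Here ∫ D = Σ d(n)(x - n), and grouping by a divisor m turns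
this into explicit terms plus Σ m `fractQuad`(x/m). Expanding `fractQuad` in its Fourier series
(index h) and applying Poisson summation in m (index k) produces a double sum of `dualTerm`s
depending only on n = hk, which explains the coefficients d(n). Each involves the oscillatory
integral `Phi`, whose stationary point supplies the sine of 4π√(nx) - π/4 (`abs_Phi_sub_le`).
Integration by parts against log t + 2γ then gives (log x + 2γ)(x/4 + G(x)) - x/4.

The bound Δ(x) = O(√x) follows from the same formula: G(x) = O(x^(3/4)), and since D is monotone one
can difference ∫ Δ over intervals of length x^(1/4). -/

namespace DivisorMeanSquare

open MeasureTheory Filter Topology Set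

/-! ### The first derivative test and truncated Fresnel integrals. -/

/-- First derivative test: an oscillating factor with bounded primitive `F`, weighted by `q`. -/
theorem norm_integral_smul_deriv_le {E : Type*} [NormedAddCommGroup E] [NormedSpace ℝ E]
    [CompleteSpace E] {F F' : ℝ → E} {q q' r r' : ℝ → ℝ} {a b K : ℝ} (hab : a ≤ b)
    (hF : ∀ t ∈ Icc a b, HasDerivAt F (F' t) t) (hF' : ContinuousOn F' (Icc a b))
    (hK : ∀ t ∈ Icc a b, ‖F t‖ ≤ K)
    (hq : ∀ t ∈ Icc a b, HasDerivAt q (q' t) t) (hq' : ContinuousOn q' (Icc a b))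
    (hr : ∀ t ∈ Icc a b, HasDerivAt r (r' t) t) (hr' : ContinuousOn r' (Icc a b))
    (hqr : ∀ t ∈ Icc a b, |q' t| ≤ r' t) :
    ‖∫ t in a..b, q t • F' t‖ ≤ K * (|q a| + |q b| + (r b - r a)) := by
  have hu : uIcc a b = Icc a b := uIcc_of_le hab
  have iq : IntervalIntegrable q' volume a b :=
    ContinuousOn.intervalIntegrable (by rwa [hu])
  have ir : IntervalIntegrable r' volume a b :=
    ContinuousOn.intervalIntegrable (by rwa [hu])
  have iF : IntervalIntegrable F' volume a b :=
    ContinuousOn.intervalIntegrable (by rwa [hu])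
  rw [intervalIntegral.integral_smul_deriv_eq_deriv_smul (by rwa [hu]) (by rwa [hu]) iq iF]
  have h1 : ‖∫ t in a..b, q' t • F t‖ ≤ ∫ t in a..b, r' t * K := by
    apply intervalIntegral.norm_integral_le_of_norm_le hab _ (ir.mul_const K)
    refine Eventually.of_forall fun t ht => ?_
    have ht' : t ∈ Icc a b := ⟨ht.1.le, ht.2⟩
    rw [norm_smul, Real.norm_eq_abs]
    exact mul_le_mul (hqr t ht') (hK t ht') (norm_nonneg _) ((abs_nonneg _).trans (hqr t ht'))
  rw [intervalIntegral.integral_mul_const,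
    intervalIntegral.integral_eq_sub_of_hasDerivAt (by rwa [hu]) ir] at h1
  have ha : ‖q a • F a‖ ≤ |q a| * K := by
    rw [norm_smul, Real.norm_eq_abs]
    exact mul_le_mul_of_nonneg_left (hK a (left_mem_Icc.2 hab)) (abs_nonneg _)
  have hb : ‖q b • F b‖ ≤ |q b| * K := by
    rw [norm_smul, Real.norm_eq_abs]
    exact mul_le_mul_of_nonneg_left (hK b (right_mem_Icc.2 hab)) (abs_nonneg _)
  calc _ ≤ ‖q b • F b‖ + ‖q a • F a‖ + ‖∫ t in a..b, q' t • F t‖ :=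
        (norm_sub_le _ _).trans (by gcongr; exact norm_sub_le _ _)
    _ ≤ |q b| * K + |q a| * K + (r b - r a) * K := by gcongr
    _ = _ := by ring

/-- The integrand is s⁻¹ times s exp(-β s²), whose primitive is bounded by 1/(2b) whatever the
damping e ≥ 0. This uniformity in e and R permits the passage to e = 0 in `norm_fresnel_sub_le`. -/
theorem norm_integral_gaussian_tail_le {e b S R : ℝ} (he : 0 ≤ e) (hb : 0 < b) (hS : 0 < S)
    (hR : S ≤ R) :
    ‖∫ s in S..R, Complex.exp (-(e - Complex.I * b : ℂ) * (s : ℂ) ^ 2)‖ ≤ 1 / (b * S) := by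
  set β : ℂ := e - Complex.I * b with hβ
  have hβre : β.re = e := by simp [hβ]
  have hβim : β.im = -b := by simp [hβ]
  have hβ0 : β ≠ 0 := by
    intro h; rw [h] at hβim; simp at hβim; linarith
  have hβn : b ≤ ‖β‖ := by
    have := Complex.abs_im_le_norm β
    rwa [hβim, abs_neg, abs_of_pos hb] at this
  have key := norm_integral_smul_deriv_le (E := ℂ) (a := S) (b := R) (K := 1 / (2 * b))
    (F := fun s : ℝ => -(1 / (2 * β)) * Complex.exp (-β * (s : ℂ) ^ 2))
    (F' := fun s : ℝ => (s : ℂ) * Complex.exp (-β * (s : ℂ) ^ 2))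
    (q := fun s => s⁻¹) (q' := fun s => -(s ^ 2)⁻¹) (r := fun s => -s⁻¹) (r' := fun s => (s ^ 2)⁻¹)
    hR ?_ ?_ ?_ ?_ ?_ ?_ ?_ ?_
  · have hR0 : 0 < R := hS.trans_le hR
    have e1 : ∫ s in S..R, s⁻¹ • ((s : ℂ) * Complex.exp (-β * (s : ℂ) ^ 2)) =
        ∫ s in S..R, Complex.exp (-β * (s : ℂ) ^ 2) := by
      apply intervalIntegral.integral_congr
      intro s hs
      rw [uIcc_of_le hR] at hs
      have hs0 : (s : ℂ) ≠ 0 := by exact_mod_cast (hS.trans_le hs.1).ne'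
      simp only [Complex.real_smul, Complex.ofReal_inv]
      field_simp
    rw [e1] at key
    refine key.trans (le_of_eq ?_)
    rw [abs_of_pos (inv_pos.2 hS), abs_of_pos (inv_pos.2 hR0)]
    field_simp
    ring
  · intro t _
    have h1 : HasDerivAt (fun s : ℝ => (s : ℂ)) 1 t := Complex.ofRealCLM.hasDerivAt
    have h2 := ((h1.pow 2).const_mul (-β)).cexp.const_mul (-(1 / (2 * β)))
    refine h2.congr_deriv ?_
    simp only [Pi.pow_apply]
    field_simp
    norm_num
  · fun_prop
  · intro t _
    rw [norm_mul, Complex.norm_exp]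
    have : (-β * (t : ℂ) ^ 2).re ≤ 0 := by
      rw [← Complex.ofReal_pow, Complex.re_mul_ofReal, Complex.neg_re, hβre]
      nlinarith [sq_nonneg t]
    have h3 : ‖-(1 / (2 * β))‖ ≤ 1 / (2 * b) := by
      rw [norm_neg, norm_div, norm_mul]
      simp only [norm_one, Complex.norm_ofNat]
      gcongr
    calc _ ≤ 1 / (2 * b) * 1 := mul_le_mul h3 (Real.exp_le_one_iff.2 this) (Real.exp_pos _).le
          (by positivity)
      _ = _ := mul_one _
  · intro t ht
    exact hasDerivAt_inv (hS.trans_le ht.1).ne'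
  · exact ((continuousOn_id.pow 2).inv₀ fun t ht => (pow_pos (hS.trans_le ht.1) 2).ne').neg
  · intro t ht
    simpa using! (hasDerivAt_inv (hS.trans_le ht.1).ne').neg
  · exact ((continuousOn_id.pow 2).inv₀ fun t ht => (pow_pos (hS.trans_le ht.1) 2).ne')
  · intro t ht
    rw [abs_neg, abs_of_nonneg (by positivity)]

theorem sqrt_pi_div_neg_I_mul {b : ℝ} (hb : 0 < b) :
    ((Real.pi : ℂ) / (-(Complex.I * b))) ^ (1 / 2 : ℂ) =
      Real.sqrt (Real.pi / b) * Complex.exp (Complex.I * (Real.pi / 4 : ℝ)) := by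
  have h0 : (Real.pi : ℂ) / (-(Complex.I * b)) = ((Real.pi / b : ℝ) : ℂ) * Complex.I := by
    have : (b : ℂ) ≠ 0 := by exact_mod_cast hb.ne'
    push_cast
    field_simp
    rw [Complex.I_sq]
  have hp : 0 < Real.pi / b := by positivity
  rw [h0, Complex.cpow_def_of_ne_zero (by simp [hb.ne', Real.pi_ne_zero]),
    Complex.log_ofReal_mul hp Complex.I_ne_zero, Complex.log_I, add_mul, Complex.exp_add,
    Real.sqrt_eq_rpow, Complex.ofReal_cpow hp.le,
    Complex.cpow_def_of_ne_zero (by exact_mod_cast hp.ne'), Complex.ofReal_log hp.le]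
  congr 2
  · push_cast; ring_nf
  · push_cast; ring

/-- Abel regularisation: for e > 0 the complete Gaussian integral is known and the tail beyond S is
at most 1/(bS) uniformly in e. Both terms are continuous at e = 0, since π/(-ib) = iπ/b stays off
the branch cut of the square root. -/
theorem norm_fresnel_sub_le {b S : ℝ} (hb : 0 < b) (hS : 0 < S) :
    ‖(∫ s in (0 : ℝ)..S, Complex.exp (Complex.I * b * (s : ℂ) ^ 2)) -
      Real.sqrt (Real.pi / b) * Complex.exp (Complex.I * (Real.pi / 4 : ℝ)) / 2‖ ≤ 1 / (b * S) := by
  have h1 : ∀ e : ℝ, 0 < e →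
      ‖(∫ s in (0 : ℝ)..S, Complex.exp (-(e - Complex.I * b : ℂ) * (s : ℂ) ^ 2)) -
        ((Real.pi : ℂ) / (e - Complex.I * b)) ^ (1 / 2 : ℂ) / 2‖ ≤ 1 / (b * S) := by
    intro e he
    have hre : 0 < (e - Complex.I * b : ℂ).re := by simpa using he
    have hint := integrable_cexp_neg_mul_sq hre
    have ht := intervalIntegral_tendsto_integral_Ioi 0 hint.integrableOn tendsto_id
    rw [integral_gaussian_complex_Ioi hre] at ht
    have ht2 := (ht.const_sub
      (∫ s in (0 : ℝ)..S, Complex.exp (-(e - Complex.I * b : ℂ) * (s : ℂ) ^ 2))).norm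
    refine le_of_tendsto ht2 ?_
    filter_upwards [eventually_ge_atTop S] with R hR
    rw [id, norm_sub_rev, intervalIntegral.integral_interval_sub_left hint.intervalIntegrable
      hint.intervalIntegrable]
    exact norm_integral_gaussian_tail_le he.le hb hS hR
  have hc : ContinuousAt (fun e : ℝ =>
      ‖(∫ s in (0 : ℝ)..S, Complex.exp (-(e - Complex.I * b : ℂ) * (s : ℂ) ^ 2)) -
        ((Real.pi : ℂ) / (e - Complex.I * b)) ^ (1 / 2 : ℂ) / 2‖) 0 := by
    have hb' : (b : ℂ) ≠ 0 := by exact_mod_cast hb.ne'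
    refine (ContinuousAt.sub ?_ ?_).norm
    · exact (intervalIntegral.continuous_parametric_intervalIntegral_of_continuous'
        (f := fun (e s : ℝ) => Complex.exp (-(e - Complex.I * b : ℂ) * (s : ℂ) ^ 2))
        (by fun_prop) 0 S).continuousAt
    · refine ContinuousAt.div_const (ContinuousAt.cpow ?_ continuousAt_const ?_) 2
      · refine ContinuousAt.div continuousAt_const (by fun_prop) ?_
        simp [hb.ne']
      · right
        have h0 : (Real.pi : ℂ) / ((0 : ℝ) - Complex.I * b) = ((Real.pi / b : ℝ) : ℂ) * Complex.I := by
          push_cast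
          rw [zero_sub]
          field_simp
          rw [Complex.I_sq]
        rw [h0]
        simp [hb.ne', Real.pi_ne_zero]
  have h2 := le_of_tendsto (hc.tendsto.mono_left (nhdsWithin_le_nhds (s := Ioi 0)))
    (eventually_nhdsWithin_of_forall (s := Ioi 0) fun e he => h1 e he)
  simp only [Complex.ofReal_zero, zero_sub, neg_neg] at h2
  rwa [sqrt_pi_div_neg_I_mul hb] at h2

theorem abs_fresnel_cos_sub_le {b S : ℝ} (a : ℝ) (hb : 0 < b) (hS : 0 < S) :
    |(∫ s in (0 : ℝ)..S, Real.cos (a + b * s ^ 2)) -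
      Real.sqrt (Real.pi / b) / 2 * Real.cos (a + Real.pi / 4)| ≤ 1 / (b * S) := by
  have h := norm_fresnel_sub_le hb hS
  set z : ℂ := (∫ s in (0 : ℝ)..S, Complex.exp (Complex.I * b * (s : ℂ) ^ 2)) -
      Real.sqrt (Real.pi / b) * Complex.exp (Complex.I * (Real.pi / 4 : ℝ)) / 2 with hz
  have hre : (Complex.exp (Complex.I * a) * z).re = (∫ s in (0 : ℝ)..S, Real.cos (a + b * s ^ 2)) -
      Real.sqrt (Real.pi / b) / 2 * Real.cos (a + Real.pi / 4) := by
    rw [hz, mul_sub, Complex.sub_re, ← intervalIntegral.integral_const_mul]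
    congr 1
    · have : ∀ s : ℝ, Complex.exp (Complex.I * a) * Complex.exp (Complex.I * b * (s : ℂ) ^ 2) =
          Complex.exp (((a + b * s ^ 2 : ℝ) : ℂ) * Complex.I) := by
        intro s; rw [← Complex.exp_add]; congr 1; push_cast; ring
      simp_rw [this]
      have h3 := Complex.reCLM.intervalIntegral_comp_comm (a := 0) (b := S) (μ := volume)
        (f := fun s : ℝ => Complex.exp (((a + b * s ^ 2 : ℝ) : ℂ) * Complex.I))
        (Continuous.intervalIntegrable (by fun_prop) _ _)
      simp only [Complex.reCLM_apply, Complex.exp_ofReal_mul_I_re] at h3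
      exact h3.symm
    · have : Complex.exp (Complex.I * a) * (Real.sqrt (Real.pi / b) *
          Complex.exp (Complex.I * (Real.pi / 4 : ℝ)) / 2) =
          ((Real.sqrt (Real.pi / b) / 2 : ℝ) : ℂ) *
            Complex.exp (((a + Real.pi / 4 : ℝ) : ℂ) * Complex.I) := by
        have : ((a + Real.pi / 4 : ℝ) : ℂ) * Complex.I =
          Complex.I * a + Complex.I * (Real.pi / 4 : ℝ) := by push_cast; ring
        rw [this, Complex.exp_add]; push_cast; ring
      rw [this, Complex.re_ofReal_mul, Complex.exp_ofReal_mul_I_re]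
  rw [← hre]
  refine (Complex.abs_re_le_norm _).trans ?_
  rw [norm_mul, mul_comm Complex.I, Complex.norm_exp_ofReal_mul_I, one_mul]
  exact h

/-! ### The oscillatory integral `Phi` and its asymptotics. -/

/-- The derivative of `u * (1 - cos (p / u))` is `kern (p / u)`. -/
noncomputable def kern (z : ℝ) : ℝ := 1 - Real.cos z - z * Real.sin z

theorem continuous_kern : Continuous kern := by unfold kern; fun_prop

theorem abs_kern_le_sq (z : ℝ) : |kern z| ≤ 3 / 2 * z ^ 2 := by
  have h1 : |z * Real.sin z| ≤ z ^ 2 := by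
    rw [abs_mul, ← sq_abs z, sq]
    exact mul_le_mul_of_nonneg_left Real.abs_sin_le_abs (abs_nonneg z)
  have h2 := Real.one_sub_sq_div_two_le_cos (x := z)
  have h3 := Real.cos_le_one z
  rw [abs_le] at h1 ⊢
  unfold kern
  constructor <;> nlinarith [h1.1, h1.2]

theorem abs_kern_le (z : ℝ) : |kern z| ≤ 2 + |z| := by
  have h1 : |z * Real.sin z| ≤ |z| := by
    rw [abs_mul]
    exact mul_le_of_le_one_right (abs_nonneg z) (Real.abs_sin_le_one z)
  have h2 := Real.neg_one_le_cos z
  have h3 := Real.cos_le_one z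
  rw [abs_le] at h1 ⊢
  unfold kern
  constructor <;> linarith [h1.1, h1.2]

/-- Near u = 0 the linear growth of `kern` in p/u is offset by |sin(cu)| ≤ |c|u. With the quadratic
vanishing of `kern` at 0, which controls large u, this makes the integrals over (0, ∞) absolutely
convergent. -/
theorem abs_kern_mul_sin_le (p c : ℝ) {u : ℝ} (hu : 0 < u) :
    |kern (p / u) * Real.sin (c * u)| ≤ 2 + |p * c| := by
  have h1 := abs_kern_le (p / u)
  have h2 : |Real.sin (c * u)| ≤ 1 := Real.abs_sin_le_one _
  have h3 : |Real.sin (c * u)| ≤ |c| * u := by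
    refine Real.abs_sin_le_abs.trans ?_
    rw [abs_mul, abs_of_pos hu]
  have h4 : |p / u| * (|c| * u) = |p * c| := by
    rw [abs_div, abs_of_pos hu, abs_mul]; field_simp
  rw [abs_mul]
  calc _ ≤ (2 + |p / u|) * |Real.sin (c * u)| := by gcongr
    _ = 2 * |Real.sin (c * u)| + |p / u| * |Real.sin (c * u)| := by ring
    _ ≤ 2 * 1 + |p / u| * (|c| * u) := by gcongr
    _ = _ := by rw [h4, mul_one]

theorem aestronglyMeasurable_kern_mul_sin (p c : ℝ) (μ : Measure ℝ) :
    AEStronglyMeasurable (fun u => kern (p / u) * Real.sin (c * u)) μ := by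
  have h1 : Measurable fun u : ℝ => kern (p / u) :=
    continuous_kern.measurable.comp (measurable_const.div measurable_id)
  have h2 : Measurable fun u : ℝ => Real.sin (c * u) := by fun_prop
  exact (h1.mul h2).aestronglyMeasurable

theorem integrableOn_kern_mul_sin (p c : ℝ) :
    IntegrableOn (fun u => kern (p / u) * Real.sin (c * u)) (Ioi 0) := by
  rw [← Ioc_union_Ioi_eq_Ioi zero_le_one]
  refine IntegrableOn.union ?_ ?_
  · refine Measure.integrableOn_of_bounded (M := 2 + |p * c|) (by simp)
      (aestronglyMeasurable_kern_mul_sin p c _) ?_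
    filter_upwards [ae_restrict_mem measurableSet_Ioc] with u hu
    exact abs_kern_mul_sin_le p c hu.1
  · have hi : IntegrableOn (fun u : ℝ => 3 / 2 * p ^ 2 * u ^ (-2 : ℝ)) (Ioi 1) :=
      (integrableOn_Ioi_rpow_of_lt (by norm_num) one_pos).const_mul _
    refine hi.mono' (aestronglyMeasurable_kern_mul_sin p c _) ?_
    filter_upwards [ae_restrict_mem measurableSet_Ioi] with u hu
    have hu0 : (0 : ℝ) < u := one_pos.trans hu
    rw [Real.norm_eq_abs, abs_mul]
    calc _ ≤ 3 / 2 * (p / u) ^ 2 * 1 := by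
          gcongr
          · exact abs_kern_le_sq _
          · exact Real.abs_sin_le_one _
      _ = _ := by
          rw [Real.rpow_neg hu0.le, Real.rpow_two]; field_simp

/-- The oscillatory integral governing the dual side of Voronoi summation. -/
noncomputable def Phi (l : ℝ) : ℝ :=
  -(1 / l) * ∫ w in Ioi (0 : ℝ), kern (l / w) * Real.sin (l * w)

theorem hasDerivAt_arctan_sinh (t : ℝ) :
    HasDerivAt (fun s => Real.arctan (Real.sinh s)) (Real.cosh t)⁻¹ t := by
  refine ((Real.hasDerivAt_sinh t).arctan).congr_deriv ?_
  have h := Real.cosh_sq t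
  have h0 := Real.cosh_pos t
  rw [add_comm 1, ← h]
  field_simp

/-- The phase 2l sinh t has no stationary point: its derivative is 2l cosh t. The weight 1/cosh t
has total variation at most ∫ 1/cosh ≤ π < 4, with primitive arctan(sinh t). -/
theorem abs_integral_cos_sinh_le {l : ℝ} (hl : 0 < l) {T : ℝ} (hT : 0 ≤ T) :
    |∫ t in (-T)..T, Real.cos (2 * l * Real.sinh t)| ≤ 3 / l := by
  have key := norm_integral_smul_deriv_le (E := ℝ) (a := -T) (b := T) (K := 1 / (2 * l))
    (F := fun t => Real.sin (2 * l * Real.sinh t) / (2 * l))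
    (F' := fun t => Real.cos (2 * l * Real.sinh t) * Real.cosh t)
    (q := fun t => (Real.cosh t)⁻¹) (q' := fun t => -Real.sinh t / Real.cosh t ^ 2)
    (r := fun t => Real.arctan (Real.sinh t)) (r' := fun t => (Real.cosh t)⁻¹)
    (by linarith) ?_ (by fun_prop) ?_ ?_ ?_ (fun t _ => hasDerivAt_arctan_sinh t) ?_ ?_
  · have e1 : ∀ t : ℝ, (Real.cosh t)⁻¹ • (Real.cos (2 * l * Real.sinh t) * Real.cosh t) =
        Real.cos (2 * l * Real.sinh t) := by
      intro t
      have := Real.cosh_pos t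
      rw [smul_eq_mul]; field_simp
    simp_rw [e1] at key
    refine key.trans ?_
    have h1 : ∀ t : ℝ, |(Real.cosh t)⁻¹| ≤ 1 := fun t => by
      rw [abs_of_pos (inv_pos.2 (Real.cosh_pos t))]
      exact inv_le_one_of_one_le₀ (Real.one_le_cosh t)
    have h2 := h1 T
    have h3 := h1 (-T)
    have h4 := Real.arctan_lt_pi_div_two (Real.sinh T)
    have h5 := Real.neg_pi_div_two_lt_arctan (Real.sinh (-T))
    have h6 := Real.pi_lt_four
    calc _ ≤ 1 / (2 * l) * 6 := by gcongr; linarith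
      _ = _ := by field_simp; norm_num
  · intro t _
    refine (((Real.hasDerivAt_sinh t).const_mul (2 * l)).sin.div_const (2 * l)).congr_deriv ?_
    field_simp
  · intro t _
    rw [Real.norm_eq_abs, abs_div, abs_of_pos (by positivity : 0 < 2 * l)]
    gcongr
    exact Real.abs_sin_le_one _
  · intro t _
    exact (Real.hasDerivAt_cosh t).inv (Real.cosh_pos t).ne'
  · exact Continuous.continuousOn (by
      refine Continuous.div (by fun_prop) (by fun_prop) fun t => (pow_pos (Real.cosh_pos t) 2).ne')
  · exact Continuous.continuousOn (Continuous.inv₀ (by fun_prop) fun t => (Real.cosh_pos t).ne')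
  · intro t _
    have h0 := Real.cosh_pos t
    have h1 : |Real.sinh t| ≤ Real.cosh t := by
      have := Real.cosh_sq t
      exact abs_le_of_sq_le_sq (by linarith) h0.le
    rw [abs_div, abs_neg, abs_of_pos (pow_pos h0 2), div_le_iff₀ (pow_pos h0 2)]
    calc _ ≤ Real.cosh t := h1
      _ = _ := by field_simp

/-- The phase is stationary at t = 0, but cosh t - 1 = sinh² t/(cosh t + 1) vanishes there. After
division by the factor sinh t cosh t from the phase derivative, a bounded weight of bounded
variation remains, so the first derivative test applies. -/
theorem abs_integral_cos_sinh_sq_mul_cosh_sub_one_le {l : ℝ} (hl : 0 < l) {S : ℝ} (hS : 0 ≤ S) :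
    |∫ t in (-S)..S, Real.cos (2 * l + 4 * l * Real.sinh t ^ 2) * (Real.cosh t - 1)| ≤ 2 / l := by
  have key := norm_integral_smul_deriv_le (E := ℝ) (a := -S) (b := S) (K := 1 / (8 * l))
    (F := fun t => Real.sin (2 * l + 4 * l * Real.sinh t ^ 2) / (8 * l))
    (F' := fun t => Real.cos (2 * l + 4 * l * Real.sinh t ^ 2) * (Real.sinh t * Real.cosh t))
    (q := fun t => Real.sinh t / ((Real.cosh t + 1) * Real.cosh t))
    (q' := fun t => (1 + Real.cosh t - Real.cosh t ^ 2) / ((Real.cosh t + 1) * Real.cosh t ^ 2))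
    (r := fun t => 2 * Real.arctan (Real.sinh t)) (r' := fun t => 2 * (Real.cosh t)⁻¹)
    (by linarith) ?_ (by fun_prop) ?_ ?_ ?_
    (fun t _ => (hasDerivAt_arctan_sinh t).const_mul 2) ?_ ?_
  · have e1 : ∀ t : ℝ, (Real.sinh t / ((Real.cosh t + 1) * Real.cosh t)) •
        (Real.cos (2 * l + 4 * l * Real.sinh t ^ 2) * (Real.sinh t * Real.cosh t)) =
        Real.cos (2 * l + 4 * l * Real.sinh t ^ 2) * (Real.cosh t - 1) := by
      intro t
      have h0 := Real.cosh_pos t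
      have h1 := Real.sinh_sq t
      rw [smul_eq_mul]
      field_simp
      rw [h1]
      ring
    simp_rw [e1] at key
    refine key.trans ?_
    have h1 : ∀ t : ℝ, |Real.sinh t / ((Real.cosh t + 1) * Real.cosh t)| ≤ 1 := fun t => by
      have h0 := Real.one_le_cosh t
      have h1 : |Real.sinh t| ≤ Real.cosh t := by
        have := Real.cosh_sq t
        exact abs_le_of_sq_le_sq (by linarith) (by linarith)
      rw [abs_div, abs_of_pos (by positivity : 0 < (Real.cosh t + 1) * Real.cosh t),
        div_le_one (by positivity)]
      nlinarith
    have h2 := h1 S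
    have h3 := h1 (-S)
    have h4 := Real.arctan_lt_pi_div_two (Real.sinh S)
    have h5 := Real.neg_pi_div_two_lt_arctan (Real.sinh (-S))
    have h6 := Real.pi_lt_four
    calc _ ≤ 1 / (8 * l) * 16 := by gcongr; linarith
      _ = _ := by field_simp; norm_num
  · intro t _
    refine (((((Real.hasDerivAt_sinh t).pow 2).const_mul (4 * l)).const_add
      (2 * l)).sin.div_const (8 * l)).congr_deriv ?_
    simp only [Pi.pow_apply]
    field_simp
    push_cast
    ring
  · intro t _
    rw [Real.norm_eq_abs, abs_div, abs_of_pos (by positivity : 0 < 8 * l)]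
    gcongr
    exact Real.abs_sin_le_one _
  · intro t _
    have h0 := Real.cosh_pos t
    have h1 := Real.sinh_sq t
    refine ((Real.hasDerivAt_sinh t).div (((Real.hasDerivAt_cosh t).add_const 1).mul
      (Real.hasDerivAt_cosh t)) (by simp only [Pi.mul_apply]; positivity)).congr_deriv ?_
    simp only [Pi.mul_apply]
    field_simp
    linear_combination (-(2 * Real.cosh t + 1)) * h1
  · refine Continuous.continuousOn (Continuous.div (by fun_prop) (by fun_prop) fun t => ?_)
    have := Real.cosh_pos t
    positivity
  · exact Continuous.continuousOn
      (continuous_const.mul (Continuous.inv₀ (by fun_prop) fun t => (Real.cosh_pos t).ne'))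
  · intro t _
    have h0 := Real.one_le_cosh t
    rw [abs_div, abs_of_pos (by positivity : 0 < (Real.cosh t + 1) * Real.cosh t ^ 2),
      div_le_iff₀ (by positivity)]
    have : 2 * (Real.cosh t)⁻¹ * ((Real.cosh t + 1) * Real.cosh t ^ 2) =
        2 * (Real.cosh t + 1) * Real.cosh t := by field_simp
    rw [this, abs_le]
    constructor <;> nlinarith

/-- By the half-angle formula cosh 2t = 1 + 2 sinh² t, the phase becomes exactly quadratic in s =
sinh t. Inserting the Jacobian cosh t gives a Fresnel integral, and the correction cosh t - 1 costs
only O(1/l). -/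
theorem abs_integral_cos_cosh_sub_le {l : ℝ} (hl : 0 < l) {S : ℝ} (hS : 1 ≤ S) :
    |(∫ t in (-(2 * S))..(2 * S), Real.cos (2 * l * Real.cosh t)) +
      Real.sqrt Real.pi / Real.sqrt l * Real.sin (2 * l - Real.pi / 4)| ≤ 5 / l := by
  have hS0 : 0 ≤ S := by linarith
  have e1 : (∫ t in (-(2 * S))..(2 * S), Real.cos (2 * l * Real.cosh t)) =
      2 * ∫ t in (-S)..S, Real.cos (2 * l + 4 * l * Real.sinh t ^ 2) := by
    have := intervalIntegral.integral_comp_mul_left (a := -S) (b := S)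
      (fun t => Real.cos (2 * l * Real.cosh t)) (two_ne_zero)
    rw [mul_neg, smul_eq_mul] at this
    have e2 : ∀ t : ℝ, Real.cos (2 * l * Real.cosh (2 * t)) =
        Real.cos (2 * l + 4 * l * Real.sinh t ^ 2) := by
      intro t
      congr 1
      rw [Real.cosh_two_mul, Real.cosh_sq]; ring
    simp_rw [e2] at this
    linarith
  have e2 : (∫ t in (-S)..S, Real.cos (2 * l + 4 * l * Real.sinh t ^ 2)) =
      (∫ t in (-S)..S, Real.cos (2 * l + 4 * l * Real.sinh t ^ 2) * Real.cosh t) -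
      ∫ t in (-S)..S, Real.cos (2 * l + 4 * l * Real.sinh t ^ 2) * (Real.cosh t - 1) := by
    rw [← intervalIntegral.integral_sub (Continuous.intervalIntegrable (by fun_prop) _ _)
      (Continuous.intervalIntegrable (by fun_prop) _ _)]
    congr 1; ext t; ring
  have e3 : (∫ t in (-S)..S, Real.cos (2 * l + 4 * l * Real.sinh t ^ 2) * Real.cosh t) =
      2 * ∫ s in (0 : ℝ)..(Real.sinh S), Real.cos (2 * l + 4 * l * s ^ 2) := by
    have h := intervalIntegral.integral_comp_mul_deriv (a := -S) (b := S)
      (f := Real.sinh) (f' := Real.cosh) (g := fun s => Real.cos (2 * l + 4 * l * s ^ 2))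
      (fun x _ => Real.hasDerivAt_sinh x) (by fun_prop) (by fun_prop)
    simp only [Function.comp_def] at h
    rw [h, Real.sinh_neg, ← intervalIntegral.integral_add_adjacent_intervals (b := 0)
      (Continuous.intervalIntegrable (by fun_prop) _ _)
      (Continuous.intervalIntegrable (by fun_prop) _ _)]
    have h2 := intervalIntegral.integral_comp_neg (a := 0) (b := Real.sinh S)
      (fun s => Real.cos (2 * l + 4 * l * s ^ 2))
    simp only [neg_sq, neg_zero] at h2
    rw [← h2]; ring
  have hsinh : 1 ≤ Real.sinh S := hS.trans (Real.self_le_sinh_iff.2 hS0)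
  have h1 := abs_fresnel_cos_sub_le (2 * l) (by positivity : 0 < 4 * l)
    (by linarith : 0 < Real.sinh S)
  have h2 := abs_integral_cos_sinh_sq_mul_cosh_sub_one_le hl hS0
  have e4 : Real.sqrt (Real.pi / (4 * l)) / 2 * Real.cos (2 * l + Real.pi / 4) =
      -(Real.sqrt Real.pi / Real.sqrt l * Real.sin (2 * l - Real.pi / 4)) / 4 := by
    have : Real.sin (2 * l - Real.pi / 4) = -Real.cos (2 * l + Real.pi / 4) := by
      have h := Real.cos_add_pi_div_two (2 * l - Real.pi / 4)
      rw [show 2 * l - Real.pi / 4 + Real.pi / 2 = 2 * l + Real.pi / 4 by ring] at h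
      linarith
    rw [this, Real.sqrt_div Real.pi_pos.le, Real.sqrt_mul (by norm_num),
      (by norm_num : (4 : ℝ) = 2 ^ 2), Real.sqrt_sq (by norm_num)]
    have := Real.sqrt_pos.2 hl
    field_simp
  have h3 : 1 / (4 * l * Real.sinh S) ≤ 1 / (4 * l) :=
    one_div_le_one_div_of_le (by positivity) (by nlinarith)
  rw [e1, e2, e3]
  rw [e4] at h1
  have h1' := h1.trans h3
  have e5 : 1 / (4 * l) = 1 / l / 4 := by field_simp
  have e6 : 2 / l = 2 * (1 / l) := by ring
  have e7 : 5 / l = 5 * (1 / l) := by ring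
  rw [e5] at h1'
  rw [e6] at h2
  rw [e7]
  rw [abs_le] at h1' h2 ⊢
  constructor <;> linarith [h1'.1, h1'.2, h2.1, h2.2]

/-- On (0, 1] the trivial bound suffices. On [1, b] the weight has variation at most ∫ l/w² ≤ l,
which is balanced by the factor 1/l gained from integrating sin(lw). -/
theorem abs_integral_one_sub_cos_mul_sin_le {l : ℝ} (hl : 1 ≤ l) {a b : ℝ} (ha : 0 < a)
    (ha1 : a ≤ 1) (hb : 1 ≤ b) :
    |∫ w in a..b, (1 - Real.cos (l / w)) * Real.sin (l * w)| ≤ 7 := by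
  have hl0 : 0 < l := by linarith
  have hc : ∀ c d : ℝ, 0 < c → c ≤ d → IntervalIntegrable
      (fun w => (1 - Real.cos (l / w)) * Real.sin (l * w)) volume c d := fun c d hcp hcd => by
    refine ContinuousOn.intervalIntegrable ?_
    rw [uIcc_of_le hcd]
    have : ContinuousOn (fun w : ℝ => l / w) (Icc c d) :=
      continuousOn_const.div continuousOn_id fun w hw => (hcp.trans_le hw.1).ne'
    exact (continuousOn_const.sub (Real.continuous_cos.comp_continuousOn this)).mul (by fun_prop)
  rw [← intervalIntegral.integral_add_adjacent_intervals (hc a 1 ha ha1) (hc 1 b one_pos hb)]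
  have h1 : |∫ w in a..1, (1 - Real.cos (l / w)) * Real.sin (l * w)| ≤ 2 * |1 - a| := by
    rw [← Real.norm_eq_abs]
    refine intervalIntegral.norm_integral_le_of_norm_le_const fun w _ => ?_
    rw [Real.norm_eq_abs, abs_mul]
    have h2 : |1 - Real.cos (l / w)| ≤ 2 := by
      rw [abs_le]
      constructor <;> linarith [Real.neg_one_le_cos (l / w), Real.cos_le_one (l / w)]
    calc _ ≤ (2 : ℝ) * 1 := by gcongr; exact Real.abs_sin_le_one _
      _ = 2 := by norm_num
  have h1' : |∫ w in a..1, (1 - Real.cos (l / w)) * Real.sin (l * w)| ≤ 2 := by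
    refine h1.trans ?_
    rw [abs_of_nonneg (by linarith)]; linarith
  have key := norm_integral_smul_deriv_le (E := ℝ) (a := 1) (b := b) (K := 1 / l)
    (F := fun w => -Real.cos (l * w) / l) (F' := fun w => Real.sin (l * w))
    (q := fun w => 1 - Real.cos (l / w)) (q' := fun w => Real.sin (l / w) * -(l / w ^ 2))
    (r := fun w => -(l / w)) (r' := fun w => l / w ^ 2) hb ?_ (by fun_prop) ?_ ?_ ?_ ?_ ?_ ?_
  · have h2 : ∀ w, |1 - Real.cos (l / w)| ≤ 2 := fun w => by
      rw [abs_le]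
      constructor <;> linarith [Real.neg_one_le_cos (l / w), Real.cos_le_one (l / w)]
    have h3 : |∫ w in (1:ℝ)..b, (1 - Real.cos (l / w)) * Real.sin (l * w)| ≤ 5 := by
      refine key.trans ?_
      have h4 : 0 ≤ l / b := by positivity
      have h5 := h2 1
      have h6 := h2 b
      calc _ ≤ 1 / l * (5 * l) := by
            gcongr
            rw [div_one] at *
            linarith
        _ = 5 := by field_simp
    exact (abs_add_le _ _).trans (by linarith)
  · intro w _
    refine ((((hasDerivAt_id w).const_mul l).cos.neg).div_const l).congr_deriv ?_
    simp only [id]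
    field_simp
  · intro w _
    rw [Real.norm_eq_abs, abs_div, abs_neg, abs_of_pos hl0]
    gcongr
    exact Real.abs_cos_le_one _
  · intro w hw
    have hw0 : w ≠ 0 := by linarith [hw.1]
    refine (((hasDerivAt_const w l).div (hasDerivAt_id w) hw0).cos.const_sub 1).congr_deriv ?_
    simp only [id, Pi.div_apply]
    ring
  · have h0 : ∀ w ∈ Icc 1 b, w ≠ 0 := fun w hw => by linarith [hw.1]
    have h1 : ContinuousOn (fun w : ℝ => l / w) (Icc 1 b) :=
      continuousOn_const.div continuousOn_id h0
    have h2 : ContinuousOn (fun w : ℝ => l / w ^ 2) (Icc 1 b) :=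
      continuousOn_const.div (by fun_prop) fun w hw => pow_ne_zero 2 (h0 w hw)
    exact (Real.continuous_sin.comp_continuousOn h1).mul h2.neg
  · intro w hw
    have hw0 : w ≠ 0 := by linarith [hw.1]
    refine ((hasDerivAt_const w l).div (hasDerivAt_id w) hw0).neg.congr_deriv ?_
    simp only [id]
    ring
  · exact continuousOn_const.div (by fun_prop) fun w hw => pow_ne_zero 2 (by linarith [hw.1])
  · intro w hw
    rw [abs_mul, abs_neg, abs_of_nonneg (by positivity : 0 ≤ l / w ^ 2)]
    exact mul_le_of_le_one_left (by positivity) (Real.abs_sin_le_one _)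

/-- The substitution w = e^t turns lw ∓ l/w into 2l sinh t and 2l cosh t. As T → ∞ the two integrals
on the right tend to 2K₀(2l) and -πY₀(2l), the classical Voronoi kernels. -/
theorem integral_sin_mul_sin_eq {l T : ℝ} :
    ∫ w in (Real.exp (-T))..(Real.exp T), (l / w) * Real.sin (l / w) * Real.sin (l * w) =
      l / 2 * ((∫ t in (-T)..T, Real.cos (2 * l * Real.sinh t)) -
        ∫ t in (-T)..T, Real.cos (2 * l * Real.cosh t)) := by
  have h := intervalIntegral.integral_comp_mul_deriv' (a := -T) (b := T)
    (f := Real.exp) (f' := Real.exp)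
    (g := fun w => (l / w) * Real.sin (l / w) * Real.sin (l * w))
    (fun x _ => Real.hasDerivAt_exp x) (by fun_prop) ?_
  · rw [← h, ← intervalIntegral.integral_sub (Continuous.intervalIntegrable (by fun_prop) _ _)
      (Continuous.intervalIntegrable (by fun_prop) _ _), ← intervalIntegral.integral_const_mul]
    congr 1
    ext t
    simp only [Function.comp]
    have h0 := Real.exp_pos t
    have e1 : 2 * l * Real.sinh t = l * Real.exp t - l / Real.exp t := by
      rw [Real.sinh_eq, Real.exp_neg]; field_simp
    have e2 : 2 * l * Real.cosh t = l * Real.exp t + l / Real.exp t := by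
      rw [Real.cosh_eq, Real.exp_neg]; field_simp
    rw [e1, e2, Real.cos_sub, Real.cos_add]
    field_simp
    ring
  · have h0 : ∀ w ∈ Real.exp '' uIcc (-T) T, w ≠ 0 := by
      rintro _ ⟨t, _, rfl⟩
      exact (Real.exp_pos t).ne'
    have h1 : ContinuousOn (fun w : ℝ => l / w) (Real.exp '' uIcc (-T) T) :=
      continuousOn_const.div continuousOn_id h0
    exact (h1.mul (Real.continuous_sin.comp_continuousOn h1)).mul (by fun_prop)

/-- Splitting `kern` gives -A/l + P/2 - Q/2: A = O(1) comes from 1 - cos, P = O(1/l) from the sinh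
phase, and Q from the cosh phase, whose stationary point yields the main term. The integrals are
truncated to [e^(-2S), e^(2S)] and S tends to infinity. -/
theorem abs_Phi_sub_le {l : ℝ} (hl : 1 ≤ l) :
    |Phi l - Real.sqrt Real.pi / (2 * Real.sqrt l) * Real.sin (2 * l - Real.pi / 4)| ≤ 11 / l := by
  have hl0 : 0 < l := by linarith
  have hi := integrableOn_kern_mul_sin l l
  have hfin : ∀ S : ℝ, 1 ≤ S →
      |-(1 / l) * (∫ w in Ioc (Real.exp (-(2 * S))) (Real.exp (2 * S)),
        kern (l / w) * Real.sin (l * w) ∂(volume.restrict (Ioi 0))) -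
        Real.sqrt Real.pi / (2 * Real.sqrt l) * Real.sin (2 * l - Real.pi / 4)| ≤ 11 / l := by
    intro S hS
    have ha : 0 < Real.exp (-(2 * S)) := Real.exp_pos _
    have hab : Real.exp (-(2 * S)) ≤ Real.exp (2 * S) := Real.exp_le_exp.2 (by linarith)
    have hsub : Ioc (Real.exp (-(2 * S))) (Real.exp (2 * S)) ⊆ Ioi 0 := fun w hw => ha.trans hw.1
    rw [Measure.restrict_restrict measurableSet_Ioc, inter_eq_left.2 hsub,
      ← intervalIntegral.integral_of_le hab]
    have hcl : ContinuousOn (fun w : ℝ => l / w) (uIcc (Real.exp (-(2 * S))) (Real.exp (2 * S))) := by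
      rw [uIcc_of_le hab]
      exact continuousOn_const.div continuousOn_id fun w hw => (ha.trans_le hw.1).ne'
    have e1 : ∫ w in (Real.exp (-(2 * S)))..(Real.exp (2 * S)), kern (l / w) * Real.sin (l * w) =
        (∫ w in (Real.exp (-(2 * S)))..(Real.exp (2 * S)),
          (1 - Real.cos (l / w)) * Real.sin (l * w)) -
        ∫ w in (Real.exp (-(2 * S)))..(Real.exp (2 * S)),
          (l / w) * Real.sin (l / w) * Real.sin (l * w) := by
      rw [← intervalIntegral.integral_sub]
      · congr 1; ext w; unfold kern; ring
      · exact ContinuousOn.intervalIntegrable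
          ((continuousOn_const.sub (Real.continuous_cos.comp_continuousOn hcl)).mul (by fun_prop))
      · exact ContinuousOn.intervalIntegrable
          ((hcl.mul (Real.continuous_sin.comp_continuousOn hcl)).mul (by fun_prop))
    rw [e1, integral_sin_mul_sin_eq]
    have hA := abs_integral_one_sub_cos_mul_sin_le hl ha
      (Real.exp_le_one_iff.2 (by linarith : -(2 * S) ≤ 0))
      (Real.one_le_exp (by linarith : 0 ≤ 2 * S))
    have hP := abs_integral_cos_sinh_le hl0 (by linarith : 0 ≤ 2 * S)
    have hQ := abs_integral_cos_cosh_sub_le hl0 hS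
    set A := ∫ w in (Real.exp (-(2 * S)))..(Real.exp (2 * S)),
          (1 - Real.cos (l / w)) * Real.sin (l * w)
    set P := ∫ t in (-(2 * S))..(2 * S), Real.cos (2 * l * Real.sinh t)
    set Q := ∫ t in (-(2 * S))..(2 * S), Real.cos (2 * l * Real.cosh t)
    set s := Real.sin (2 * l - Real.pi / 4)
    have e2 : -(1 / l) * (A - l / 2 * (P - Q)) - Real.sqrt Real.pi / (2 * Real.sqrt l) * s =
        -(1 / l) * A + P / 2 - (Q + Real.sqrt Real.pi / Real.sqrt l * s) / 2 := by
      have := Real.sqrt_pos.2 hl0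
      field_simp
      ring
    rw [e2]
    have h1 : |-(1 / l) * A| ≤ 7 / l := by
      rw [abs_mul, abs_neg, abs_of_pos (by positivity : 0 < 1 / l)]
      calc _ ≤ 1 / l * 7 := by gcongr
        _ = _ := by ring
    have e3 : 3 / l = 3 * (1 / l) := by ring
    have e5 : 5 / l = 5 * (1 / l) := by ring
    have e7 : 7 / l = 7 * (1 / l) := by ring
    have e11 : 11 / l = 11 * (1 / l) := by ring
    rw [e3] at hP
    rw [e5] at hQ
    rw [e7] at h1
    rw [e11]
    rw [abs_le] at h1 hP hQ ⊢
    constructor <;> linarith [h1.1, h1.2, hP.1, hP.2, hQ.1, hQ.2]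
  have hcov : AECover (volume.restrict (Ioi (0 : ℝ))) atTop
      fun S : ℝ => Ioc (Real.exp (-(2 * S))) (Real.exp (2 * S)) := by
    refine ⟨?_, fun _ => measurableSet_Ioc⟩
    filter_upwards [ae_restrict_mem measurableSet_Ioi] with w hw
    have t1 : Tendsto (fun S : ℝ => Real.exp (2 * S)) atTop atTop :=
      Real.tendsto_exp_atTop.comp (tendsto_id.const_mul_atTop two_pos)
    have t2 : Tendsto (fun S : ℝ => Real.exp (-(2 * S))) atTop (𝓝 0) :=
      Real.tendsto_exp_neg_atTop_nhds_zero.comp (tendsto_id.const_mul_atTop two_pos)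
    filter_upwards [t1.eventually_ge_atTop w, t2.eventually_lt_const hw] with S h1 h2
    exact ⟨h2, h1⟩
  have ht := hcov.integral_tendsto_of_countably_generated hi
  refine le_of_tendsto (((ht.const_mul (-(1 / l))).sub_const
    (Real.sqrt Real.pi / (2 * Real.sqrt l) * Real.sin (2 * l - Real.pi / 4))).abs) ?_
  filter_upwards [eventually_ge_atTop 1] with S hS
  exact hfin S hS

/-! ### Poisson summation on a finite interval. -/

/-- The reflection x ↦ 1 - x conjugates the character because n is an integer, so the symmetrised
function pairs the two exponentials into a cosine. -/
theorem integral_fourier_mul_symm (a : ℝ → ℝ) (ha : Continuous a) (n : ℤ) (m : ℕ) :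
    ∫ x in (0 : ℝ)..1, Complex.exp (2 * Real.pi * Complex.I * (-n : ℤ) * x / (1 : ℝ)) *
      ((a (m + x) + a (m + 1 - x) : ℝ) : ℂ) =
      ((2 * ∫ u in (m : ℝ)..(m + 1 : ℕ), a u * Real.cos (2 * Real.pi * n * u) : ℝ) : ℂ) := by
  have h1 : ∫ x in (0 : ℝ)..1, Complex.exp (2 * Real.pi * Complex.I * (-n : ℤ) * x / (1 : ℝ)) *
      (a (m + 1 - x) : ℂ) =
      ∫ x in (0 : ℝ)..1, Complex.exp (2 * Real.pi * Complex.I * n * x) * (a (m + x) : ℂ) := by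
    have h := intervalIntegral.integral_comp_sub_left (a := 0) (b := 1)
      (fun x : ℝ => Complex.exp (2 * Real.pi * Complex.I * n * x) * (a (m + x) : ℂ)) 1
    rw [sub_self, sub_zero] at h
    rw [← h]
    congr 1; ext x
    have e : Complex.exp (2 * Real.pi * Complex.I * n * (1 - x : ℝ)) =
        Complex.exp (2 * Real.pi * Complex.I * (-n : ℤ) * x / (1 : ℝ)) := by
      rw [Complex.exp_eq_exp_iff_exists_int]
      exact ⟨n, by push_cast; ring⟩
    rw [e, show (m : ℝ) + (1 - x) = m + 1 - x by ring]
  simp only [Complex.ofReal_add, mul_add]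
  rw [intervalIntegral.integral_add (Continuous.intervalIntegrable (by fun_prop) _ _)
    (Continuous.intervalIntegrable (by fun_prop) _ _), h1,
    ← intervalIntegral.integral_add (Continuous.intervalIntegrable (by fun_prop) _ _)
    (Continuous.intervalIntegrable (by fun_prop) _ _)]
  have h2 := intervalIntegral.integral_comp_add_left (a := 0) (b := 1)
    (fun u : ℝ => 2 * (a u * Real.cos (2 * Real.pi * n * u))) (m : ℝ)
  rw [← intervalIntegral.integral_const_mul]
  push_cast
  rw [add_zero] at h2
  rw [← h2, ← intervalIntegral.integral_ofReal]
  congr 1; ext x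
  have e : Real.cos (2 * Real.pi * n * (m + x)) = Real.cos (2 * Real.pi * n * x) := by
    rw [← Real.cos_add_int_mul_two_pi (2 * Real.pi * n * x) (n * m)]
    congr 1; push_cast; ring
  rw [e]
  push_cast
  rw [Complex.cos]
  rw [show (2 * Real.pi * n * x : ℂ) * Complex.I = 2 * Real.pi * Complex.I * n * x by ring,
    show -(2 * Real.pi * n * x : ℂ) * Complex.I = 2 * Real.pi * Complex.I * -n * x / 1 by ring]
  ring

/-- Trapezoidal form of Poisson summation on `[0, M]`. -/
theorem hasSum_integral_mul_cos {a : ℝ → ℝ} (ha : Continuous a) (M : ℕ)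
    (hs : Summable fun k : ℕ => ∫ u in (0 : ℝ)..M, a u * Real.cos (2 * Real.pi * k * u)) :
    HasSum (fun k : ℕ => 2 * ∫ u in (0 : ℝ)..M, a u * Real.cos (2 * Real.pi * (k + 1 : ℕ) * u))
      ((∑ m ∈ Finset.range M, (a m + a (m + 1 : ℕ)) / 2) - ∫ u in (0 : ℝ)..M, a u) := by
  set c : ℤ → ℝ := fun n => ∫ u in (0 : ℝ)..M, a u * Real.cos (2 * Real.pi * n * u) with hc
  -- Symmetrising each unit cell before periodising forces A(0) = A(1), so A descends to a
  -- continuous function on the circle without any matching condition on a(0) and a(M). Its value at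
  -- 0 is the trapezoidal sum.
  set A : ℝ → ℂ := fun x => ∑ m ∈ Finset.range M, ((a (m + x) + a (m + 1 - x) : ℝ) : ℂ) / 2
    with hA
  have hAc : Continuous A := by fun_prop
  have hA01 : A 0 = A (0 + 1) := by
    simp only [hA]
    refine Finset.sum_congr rfl fun m _ => ?_
    congr 2
    simp only [zero_add, add_zero, sub_zero, add_sub_cancel_right]
    ring
  let f : C(AddCircle (1 : ℝ), ℂ) :=
    ⟨AddCircle.liftIco 1 0 A, AddCircle.liftIco_continuous hA01 hAc.continuousOn⟩
  have hcoef : ∀ n : ℤ, fourierCoeff f n = (c n : ℂ) := by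
    intro n
    have h1 : fourierCoeff f n = fourierCoeff (AddCircle.liftIco 1 0 A) n := rfl
    rw [h1, fourierCoeff_liftIco_eq, fourierCoeffOn_eq_integral]
    simp only [fourier_coe_apply, smul_eq_mul, zero_add, sub_zero, hA, Finset.mul_sum]
    rw [intervalIntegral.integral_finsetSum fun m _ =>
      Continuous.intervalIntegrable (by fun_prop) _ _]
    have h2 : ∀ m : ℕ, (∫ x in (0 : ℝ)..1,
        Complex.exp (2 * Real.pi * Complex.I * (-n : ℤ) * x / (1 : ℝ)) *
          (((a (m + x) + a (m + 1 - x) : ℝ) : ℂ) / 2)) =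
        ((∫ u in (m : ℝ)..(m + 1 : ℕ), a u * Real.cos (2 * Real.pi * n * u) : ℝ) : ℂ) := by
      intro m
      simp_rw [← mul_div_assoc]
      rw [intervalIntegral.integral_div, integral_fourier_mul_symm a ha]
      push_cast; ring
    simp_rw [h2]
    rw [← Complex.ofReal_sum]
    have h3 := intervalIntegral.sum_integral_adjacent_intervals (n := M) (a := fun m : ℕ => (m : ℝ))
      (f := fun u => a u * Real.cos (2 * Real.pi * n * u)) (μ := volume)
      fun k _ => Continuous.intervalIntegrable (by fun_prop) _ _
    rw [h3]
    simp [hc]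
  have hneg : ∀ n : ℤ, c (-n) = c n := by
    intro n
    simp only [hc]
    congr 1; ext u
    rw [show 2 * Real.pi * ((-n : ℤ) : ℝ) * u = -(2 * Real.pi * n * u) by push_cast; ring,
      Real.cos_neg]
  have hcs : Summable c := by
    refine Summable.of_nat_of_neg (by simpa [hc] using hs) ?_
    simp_rw [hneg]
    simpa [hc] using hs
  have hfs : Summable (fourierCoeff f) := by
    rw [show fourierCoeff f = fun n => (c n : ℂ) from funext hcoef]
    exact Complex.ofRealCLM.summable hcs
  have h0 := has_pointwise_sum_fourier_series_of_summable hfs ((0 : ℝ) : AddCircle (1 : ℝ))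
  have hf0 : f ((0 : ℝ) : AddCircle (1 : ℝ)) = A 0 :=
    AddCircle.liftIco_coe_apply (p := 1) (a := 0) (f := A) (x := 0) (by simp)
  rw [hf0] at h0
  have hterm : (fun i => fourierCoeff f i • (fourier i) ((0 : ℝ) : AddCircle (1 : ℝ))) =
      fun i => (c i : ℂ) := by
    ext i
    rw [hcoef, fourier_coe_apply]
    simp
  rw [hterm] at h0
  have hA0 : A 0 = ((∑ m ∈ Finset.range M, (a m + a (m + 1 : ℕ)) / 2 : ℝ) : ℂ) := by
    simp [hA]
  rw [hA0] at h0
  have h1 : HasSum c (∑ m ∈ Finset.range M, (a m + a (m + 1 : ℕ)) / 2) := by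
    exact_mod_cast h0
  have h2 := h1.nat_add_neg
  simp_rw [hneg] at h2
  rw [← hasSum_nat_add_iff' 1] at h2
  have hc0 : c 0 = ∫ u in (0 : ℝ)..M, a u := by simp [hc]
  rw [Finset.sum_range_one, Nat.cast_zero, hc0] at h2
  convert! h2 using 1
  · ext k
    rw [← two_mul]
    simp only [hc, Int.cast_natCast]
  · ring

/-! ### Truncated Fourier expansion of u `fractQuad`(x/u), with bounds uniform in the truncation. -/

theorem continuous_mul_one_sub_cos (p : ℝ) : Continuous fun u : ℝ => u * (1 - Real.cos (p / u)) := by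
  rw [continuous_iff_continuousAt]
  intro u
  rcases eq_or_ne u 0 with rfl | hu
  · rw [ContinuousAt, zero_mul]
    refine squeeze_zero_norm (a := fun u : ℝ => |u| * 2) (fun u => ?_) ?_
    · rw [Real.norm_eq_abs, abs_mul]
      gcongr
      rw [abs_le]
      constructor <;> linarith [Real.neg_one_le_cos (p / u), Real.cos_le_one (p / u)]
    · have : Continuous fun u : ℝ => |u| * 2 := by fun_prop
      simpa using this.tendsto 0
  · have : ContinuousAt (fun u : ℝ => p / u) u := continuousAt_const.div continuousAt_id hu
    exact continuousAt_id.mul (continuousAt_const.sub (Real.continuous_cos.continuousAt.comp this))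

theorem hasDerivAt_const_div (p : ℝ) {u : ℝ} (hu : u ≠ 0) :
    HasDerivAt (fun u : ℝ => p / u) (-(p / u ^ 2)) u := by
  refine ((hasDerivAt_const u p).div (hasDerivAt_id u) hu).congr_deriv ?_
  simp only [id]
  ring

theorem hasDerivAt_mul_one_sub_cos (p : ℝ) {u : ℝ} (hu : u ≠ 0) :
    HasDerivAt (fun u : ℝ => u * (1 - Real.cos (p / u))) (kern (p / u)) u := by
  refine ((hasDerivAt_id u).mul ((hasDerivAt_const_div p hu).cos.const_sub 1)).congr_deriv ?_
  simp only [id, kern]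
  field_simp
  ring

theorem hasDerivAt_kern_div (p : ℝ) {u : ℝ} (hu : u ≠ 0) :
    HasDerivAt (fun u : ℝ => kern (p / u)) (p ^ 2 / u ^ 3 * Real.cos (p / u)) u := by
  have h := hasDerivAt_const_div p hu
  refine ((h.cos.const_sub 1).sub (h.mul h.sin)).congr_deriv ?_
  field_simp
  ring

/-- Partial sum of the Fourier expansion in `x / u` of `u * w (x / u)`. -/
noncomputable def gPart (x : ℝ) (H : ℕ) (u : ℝ) : ℝ :=
  ∑ h ∈ Finset.range H,
    u * (1 - Real.cos (2 * Real.pi * (h + 1) * x / u)) / (2 * Real.pi ^ 2 * (h + 1) ^ 2)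

noncomputable def gPartDeriv (x : ℝ) (H : ℕ) (u : ℝ) : ℝ :=
  ∑ h ∈ Finset.range H, kern (2 * Real.pi * (h + 1) * x / u) / (2 * Real.pi ^ 2 * (h + 1) ^ 2)

theorem continuous_gPart (x : ℝ) (H : ℕ) : Continuous (gPart x H) :=
  continuous_finsetSum _ fun _ _ => (continuous_mul_one_sub_cos _).div_const _

theorem hasDerivAt_gPart (x : ℝ) (H : ℕ) {u : ℝ} (hu : u ≠ 0) :
    HasDerivAt (gPart x H) (gPartDeriv x H u) u :=
  HasDerivAt.fun_sum fun _ _ => (hasDerivAt_mul_one_sub_cos _ hu).div_const _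

/-- Two differentiations cancel the weights 1/(h + 1)², leaving a bare cosine sum of
Dirichlet-kernel type that can be bounded independently of H. -/
theorem hasDerivAt_gPartDeriv (x : ℝ) (H : ℕ) {u : ℝ} (hu : u ≠ 0) :
    HasDerivAt (gPartDeriv x H)
      (2 * x ^ 2 / u ^ 3 * ∑ h ∈ Finset.range H, Real.cos (2 * Real.pi * (h + 1) * (x / u))) u := by
  have h : HasDerivAt (gPartDeriv x H) (∑ h ∈ Finset.range H,
      ((2 * Real.pi * (h + 1) * x) ^ 2 / u ^ 3 * Real.cos (2 * Real.pi * (h + 1) * x / u)) /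
        (2 * Real.pi ^ 2 * (h + 1) ^ 2)) u :=
    HasDerivAt.fun_sum fun _ _ => (hasDerivAt_kern_div _ hu).div_const _
  refine h.congr_deriv ?_
  rw [Finset.mul_sum]
  refine Finset.sum_congr rfl fun k _ => ?_
  have h0 : ((k : ℝ) + 1) ≠ 0 := by positivity
  have := Real.pi_ne_zero
  rw [mul_div_assoc (2 * Real.pi * ((k : ℝ) + 1)) x u]
  field_simp

/-- Multiplication by 2 sin(πy) telescopes the sum, and sin(πy) ≥ 2y for 0 < y ≤ 1/2. -/
theorem abs_sum_cos_le (H : ℕ) {y : ℝ} (hy : 0 < y) (hy2 : y ≤ 1 / 2) :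
    |∑ h ∈ Finset.range H, Real.cos (2 * Real.pi * (h + 1) * y)| ≤ 1 / (2 * y) := by
  have h1 : ∀ n : ℕ, 2 * Real.sin (Real.pi * y) *
      ∑ h ∈ Finset.range n, Real.cos (2 * Real.pi * (h + 1) * y) =
      Real.sin ((2 * n + 1) * (Real.pi * y)) - Real.sin (Real.pi * y) := by
    intro n
    induction n with
    | zero => simp
    | succ n ih =>
      rw [Finset.sum_range_succ, mul_add, ih]
      have e1 : (2 * ((n + 1 : ℕ) : ℝ) + 1) * (Real.pi * y) =
        2 * Real.pi * (n + 1) * y + Real.pi * y := by push_cast; ring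
      have e2 : (2 * (n : ℝ) + 1) * (Real.pi * y) =
        2 * Real.pi * (n + 1) * y - Real.pi * y := by ring
      rw [e1, e2, Real.sin_add, Real.sin_sub]
      ring
  have hs : 2 * y ≤ Real.sin (Real.pi * y) := by
    have := Real.mul_le_sin (x := Real.pi * y) (by positivity) (by nlinarith [Real.pi_pos])
    calc 2 * y = 2 / Real.pi * (Real.pi * y) := by field_simp
      _ ≤ _ := this
  have h2 := h1 H
  set s := ∑ h ∈ Finset.range H, Real.cos (2 * Real.pi * (h + 1) * y)
  have h3 : |2 * Real.sin (Real.pi * y) * s| ≤ 2 := by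
    rw [h2, abs_le]
    constructor <;> linarith [Real.neg_one_le_sin ((2 * H + 1) * (Real.pi * y)),
      Real.sin_le_one ((2 * H + 1) * (Real.pi * y)), Real.neg_one_le_sin (Real.pi * y),
      Real.sin_le_one (Real.pi * y)]
  rw [abs_mul, abs_of_pos (by linarith)] at h3
  rw [le_div_iff₀ (by positivity)]
  nlinarith [abs_nonneg s]

theorem abs_deriv_gPartDeriv_le {x : ℝ} (hx : 0 < x) (H : ℕ) {u : ℝ} (hu : 2 * x ≤ u) :
    |2 * x ^ 2 / u ^ 3 * ∑ h ∈ Finset.range H, Real.cos (2 * Real.pi * (h + 1) * (x / u))| ≤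
      x / u ^ 2 := by
  have hu0 : 0 < u := by linarith
  rw [abs_mul, abs_of_pos (by positivity : 0 < 2 * x ^ 2 / u ^ 3)]
  calc _ ≤ 2 * x ^ 2 / u ^ 3 * (1 / (2 * (x / u))) := by
        gcongr
        refine abs_sum_cos_le H (by positivity) ?_
        rw [div_le_div_iff₀ hu0 two_pos]; linarith
    _ = _ := by field_simp

theorem tendsto_gPartDeriv (x : ℝ) (H : ℕ) : Tendsto (gPartDeriv x H) atTop (𝓝 0) := by
  have h0 : kern 0 = 0 := by simp [kern]
  have : Tendsto (gPartDeriv x H) atTop (𝓝 (∑ h ∈ Finset.range H,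
      kern 0 / (2 * Real.pi ^ 2 * ((h : ℝ) + 1) ^ 2))) := by
    refine tendsto_finsetSum _ fun h _ => Tendsto.div_const ?_ _
    exact (continuous_kern.tendsto 0).comp (tendsto_const_nhds.div_atTop tendsto_id)
  simpa [h0] using this

/-- `gPartDeriv` tends to 0 at infinity, so it is recovered by integrating its derivative, which is
at most x/t² for t ≥ 2x. Bounding the summands separately would not give this uniformity in H so
cheaply. -/
theorem abs_gPartDeriv_le {x : ℝ} (hx : 0 < x) (H : ℕ) {u : ℝ} (hu : 2 * x ≤ u) :
    |gPartDeriv x H u| ≤ x / u := by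
  have hu0 : 0 < u := by linarith
  have h1 : ∀ R, u ≤ R → |gPartDeriv x H R - gPartDeriv x H u| ≤ x / u := by
    intro R hR
    have hpos : ∀ t ∈ Icc u R, t ≠ 0 := fun t ht => (hu0.trans_le ht.1).ne'
    have h3 : ∀ t ∈ uIcc u R, HasDerivAt (gPartDeriv x H)
        (2 * x ^ 2 / t ^ 3 * ∑ h ∈ Finset.range H, Real.cos (2 * Real.pi * (h + 1) * (x / t))) t :=
      fun t ht => hasDerivAt_gPartDeriv x H (hpos t (by rwa [uIcc_of_le hR] at ht))
    have hc : ContinuousOn (fun t : ℝ => x / t) (Icc u R) := continuousOn_const.div continuousOn_id hpos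
    have hcont : ContinuousOn (fun t : ℝ => 2 * x ^ 2 / t ^ 3 *
        ∑ h ∈ Finset.range H, Real.cos (2 * Real.pi * (h + 1) * (x / t))) (Icc u R) := by
      refine (continuousOn_const.div (by fun_prop) fun t ht => pow_ne_zero 3 (hpos t ht)).mul ?_
      exact continuousOn_finsetSum _ fun h _ =>
        Real.continuous_cos.comp_continuousOn (continuousOn_const.mul hc)
    have hcr : ContinuousOn (fun t : ℝ => x / t ^ 2) (Icc u R) :=
      continuousOn_const.div (by fun_prop) fun t ht => pow_ne_zero 2 (hpos t ht)
    rw [← intervalIntegral.integral_eq_sub_of_hasDerivAt h3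
      (ContinuousOn.intervalIntegrable (by rwa [uIcc_of_le hR]))]
    have h4 : ∫ t in u..R, x / t ^ 2 = -(x / R) - -(x / u) := by
      refine intervalIntegral.integral_eq_sub_of_hasDerivAt (f := fun t => -(x / t)) (fun t ht => ?_)
        (ContinuousOn.intervalIntegrable (by rwa [uIcc_of_le hR]))
      simpa using! (hasDerivAt_const_div x (hpos t (by rwa [uIcc_of_le hR] at ht))).neg
    have h5 := intervalIntegral.norm_integral_le_of_norm_le (μ := volume) hR
      (f := fun t : ℝ => 2 * x ^ 2 / t ^ 3 *
        ∑ h ∈ Finset.range H, Real.cos (2 * Real.pi * (h + 1) * (x / t)))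
      (Eventually.of_forall fun t ht => abs_deriv_gPartDeriv_le hx H (hu.trans ht.1.le))
      (ContinuousOn.intervalIntegrable (by rwa [uIcc_of_le hR]))
    rw [h4] at h5
    refine h5.trans ?_
    have : 0 < x / R := div_pos hx (hu0.trans_le hR)
    linarith
  have h2 := ((tendsto_gPartDeriv x H).sub_const (gPartDeriv x H u)).abs
  have h3 := le_of_tendsto h2 (by filter_upwards [eventually_ge_atTop u] with R hR using h1 R hR)
  rwa [zero_sub, abs_neg] at h3

theorem integrableOn_gPartDeriv_mul_sin (x : ℝ) (H : ℕ) (c : ℝ) :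
    IntegrableOn (fun u => gPartDeriv x H u * Real.sin (c * u)) (Ioi 0) := by
  have : (fun u => gPartDeriv x H u * Real.sin (c * u)) = fun u => ∑ h ∈ Finset.range H,
      (1 / (2 * Real.pi ^ 2 * ((h : ℝ) + 1) ^ 2)) *
        (kern (2 * Real.pi * (h + 1) * x / u) * Real.sin (c * u)) := by
    ext u
    rw [gPartDeriv, Finset.sum_mul]
    exact Finset.sum_congr rfl fun h _ => by ring
  rw [this]
  exact integrable_finsetSum _ fun h _ => (integrableOn_kern_mul_sin _ c).const_mul _

theorem abs_integral_gPartDeriv_tail_le {x : ℝ} (hx : 0 < x) (H : ℕ) {c U : ℝ} (hc : 0 < c)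
    (hU : 2 * x ≤ U) :
    |∫ u in Ioi U, gPartDeriv x H u * Real.sin (c * u)| ≤ 2 * x / (c * U) := by
  have hU0 : 0 < U := by linarith
  have hi := (integrableOn_gPartDeriv_mul_sin x H c).mono_set (Ioi_subset_Ioi hU0.le)
  have ht := intervalIntegral_tendsto_integral_Ioi U hi tendsto_id
  refine le_of_tendsto ht.abs ?_
  filter_upwards [eventually_ge_atTop U] with R hR
  have hpos : ∀ t ∈ Icc U R, t ≠ 0 := fun t ht => (hU0.trans_le ht.1).ne'
  have hcx : ContinuousOn (fun t : ℝ => x / t) (Icc U R) := continuousOn_const.div continuousOn_id hpos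
  have key := norm_integral_smul_deriv_le (E := ℝ) (a := U) (b := R) (K := 1 / c)
    (F := fun u => -Real.cos (c * u) / c) (F' := fun u => Real.sin (c * u))
    (q := gPartDeriv x H) (r := fun t => -(x / t)) (r' := fun t => x / t ^ 2) hR ?_
    (by fun_prop) ?_ (fun t ht => hasDerivAt_gPartDeriv x H (hpos t ht)) ?_ ?_ ?_
    (fun t ht => abs_deriv_gPartDeriv_le hx H (hU.trans ht.1))
  · refine key.trans ?_
    have h1 := abs_gPartDeriv_le hx H hU
    have h2 := abs_gPartDeriv_le hx H (hU.trans hR)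
    calc _ ≤ 1 / c * (2 * (x / U)) := by gcongr; linarith
      _ = _ := by field_simp
  · intro w _
    refine ((((hasDerivAt_id w).const_mul c).cos.neg).div_const c).congr_deriv ?_
    simp only [id]
    field_simp
  · intro w _
    rw [Real.norm_eq_abs, abs_div, abs_neg, abs_of_pos hc]
    gcongr
    exact Real.abs_cos_le_one _
  · refine (continuousOn_const.div (by fun_prop) fun t ht => pow_ne_zero 3 (hpos t ht)).mul ?_
    exact continuousOn_finsetSum _ fun h _ =>
      Real.continuous_cos.comp_continuousOn (continuousOn_const.mul hcx)
  · intro t ht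
    simpa using! (hasDerivAt_const_div x (hpos t ht)).neg
  · exact continuousOn_const.div (by fun_prop) fun t ht => pow_ne_zero 2 (hpos t ht)

/-! ### The dual sum over lattice points (h, k). -/

/-- Scaling u = √(p/c) w gives both phases the same frequency √(pc). Hence only the product pc
enters `Phi`, and the dual terms depend on h and k only through hk. -/
theorem integral_kern_mul_sin {p c : ℝ} (hp : 0 < p) (hc : 0 < c) :
    ∫ u in Ioi (0 : ℝ), kern (p / u) * Real.sin (c * u) = -(p * Phi (Real.sqrt (p * c))) := by
  have hb : 0 < Real.sqrt (p / c) := Real.sqrt_pos.2 (by positivity)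
  have hl : 0 < Real.sqrt (p * c) := Real.sqrt_pos.2 (by positivity)
  have h := integral_comp_mul_left_Ioi (fun u => kern (p / u) * Real.sin (c * u)) 0 hb
  have hpq : Real.sqrt (p / c) * Real.sqrt (p * c) = p := by
    rw [← Real.sqrt_mul (by positivity), show p / c * (p * c) = p ^ 2 by field_simp,
      Real.sqrt_sq hp.le]
  have hcq : c * Real.sqrt (p / c) = Real.sqrt (p * c) := by
    rw [show p * c = c ^ 2 * (p / c) by field_simp, Real.sqrt_mul (by positivity),
      Real.sqrt_sq hc.le]
  have e1 : ∀ w : ℝ, kern (p / (Real.sqrt (p / c) * w)) * Real.sin (c * (Real.sqrt (p / c) * w)) =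
      kern (Real.sqrt (p * c) / w) * Real.sin (Real.sqrt (p * c) * w) := by
    intro w
    rw [← mul_assoc, hcq, ← div_div, div_eq_of_eq_mul hb.ne' (by rw [mul_comm, hpq])]
  simp_rw [e1] at h
  rw [mul_zero, smul_eq_mul] at h
  have h2 : ∫ u in Ioi (0 : ℝ), kern (p / u) * Real.sin (c * u) = Real.sqrt (p / c) *
      ∫ w in Ioi (0 : ℝ), kern (Real.sqrt (p * c) / w) * Real.sin (Real.sqrt (p * c) * w) := by
    rw [h, mul_inv_cancel_left₀ hb.ne']
  rw [h2, Phi]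
  set J := ∫ w in Ioi (0 : ℝ), kern (Real.sqrt (p * c) / w) * Real.sin (Real.sqrt (p * c) * w)
  nth_rewrite 2 [← hpq]
  field_simp

/-- The contribution of a lattice point `(h, k)` with `h * k = n` to the dual sum. -/
noncomputable def dualTerm (x : ℝ) (n : ℕ) : ℝ :=
  x / (Real.pi ^ 2 * n) * Phi (2 * Real.pi * Real.sqrt (n * x))

/-- Integration by parts moves the derivative onto `gPart`; the boundary terms vanish because M is
an integer. The integral over (0, M] is the complete one, expressed through `Phi`, minus a tail that
is small once M ≥ 2x. -/
theorem integral_gPart_mul_cos {x : ℝ} (hx : 0 < x) (H M k : ℕ) :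
    ∫ u in (0 : ℝ)..M, gPart x H u * Real.cos (2 * Real.pi * (k + 1 : ℕ) * u) =
      (∑ h ∈ Finset.range H, dualTerm x ((h + 1) * (k + 1))) / 2 +
      1 / (2 * Real.pi * (k + 1 : ℕ)) *
        ∫ u in Ioi (M : ℝ), gPartDeriv x H u * Real.sin (2 * Real.pi * (k + 1 : ℕ) * u) := by
  have hpi := Real.pi_pos
  set c : ℝ := 2 * Real.pi * (k + 1 : ℕ) with hc
  have hc0 : 0 < c := by positivity
  have hi := integrableOn_gPartDeriv_mul_sin x H c
  have hM : (0 : ℝ) ≤ M := Nat.cast_nonneg M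
  have hi0 : IntervalIntegrable (fun u => gPartDeriv x H u * Real.sin (c * u)) volume 0 M :=
    (intervalIntegrable_iff_integrableOn_Ioc_of_le hM).2 (hi.mono_set fun u hu => hu.1)
  have hcg := continuous_gPart x H
  have hi1 : IntervalIntegrable (fun u => gPart x H u * (Real.cos (c * u) * c)) volume 0 M :=
    Continuous.intervalIntegrable (by fun_prop) _ _
  have h1 : ∫ u in (0 : ℝ)..M, (gPartDeriv x H u * Real.sin (c * u) +
      gPart x H u * (Real.cos (c * u) * c)) =
      gPart x H M * Real.sin (c * M) - gPart x H 0 * Real.sin (c * 0) := by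
    refine intervalIntegral.integral_eq_sub_of_hasDerivAt_of_le
      (f := fun u => gPart x H u * Real.sin (c * u)) hM (by fun_prop) (fun u hu => ?_) (hi0.add hi1)
    refine ((hasDerivAt_gPart x H hu.1.ne').mul
      ((hasDerivAt_id u).const_mul c).sin).congr_deriv ?_
    simp only [id]
    ring
  have hsin : Real.sin (c * M) = 0 := by
    rw [show c * M = ((2 * (k + 1) * M : ℕ) : ℝ) * Real.pi by rw [hc]; push_cast; ring]
    exact Real.sin_nat_mul_pi _
  rw [intervalIntegral.integral_add hi0 hi1, hsin, mul_zero, mul_zero, Real.sin_zero, mul_zero,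
    sub_zero] at h1
  have h2 : ∫ u in (0 : ℝ)..M, gPart x H u * (Real.cos (c * u) * c) =
      (∫ u in (0 : ℝ)..M, gPart x H u * Real.cos (c * u)) * c := by
    rw [← intervalIntegral.integral_mul_const]
    congr 1; ext u; ring
  have h3 : (∫ u in (0 : ℝ)..M, gPartDeriv x H u * Real.sin (c * u)) =
      (∫ u in Ioi (0 : ℝ), gPartDeriv x H u * Real.sin (c * u)) -
        ∫ u in Ioi (M : ℝ), gPartDeriv x H u * Real.sin (c * u) := by
    rw [← intervalIntegral.integral_Ioi_sub_Ioi hi hM]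
  have h4 : (∫ u in Ioi (0 : ℝ), gPartDeriv x H u * Real.sin (c * u)) =
      -(c / 2 * ∑ h ∈ Finset.range H, dualTerm x ((h + 1) * (k + 1))) := by
    have : (fun u => gPartDeriv x H u * Real.sin (c * u)) = fun u => ∑ h ∈ Finset.range H,
        (1 / (2 * Real.pi ^ 2 * ((h : ℝ) + 1) ^ 2)) *
          (kern (2 * Real.pi * (h + 1) * x / u) * Real.sin (c * u)) := by
      ext u
      rw [gPartDeriv, Finset.sum_mul]
      exact Finset.sum_congr rfl fun h _ => by ring
    rw [this, integral_finsetSum _ fun h _ => (integrableOn_kern_mul_sin _ c).const_mul _,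
      Finset.mul_sum, ← Finset.sum_neg_distrib]
    refine Finset.sum_congr rfl fun h _ => ?_
    rw [integral_const_mul, integral_kern_mul_sin (by positivity) hc0, dualTerm]
    have e : Real.sqrt (2 * Real.pi * (h + 1) * x * c) =
        2 * Real.pi * Real.sqrt (((h + 1) * (k + 1) : ℕ) * x) := by
      rw [show 2 * Real.pi * (h + 1) * x * c = (2 * Real.pi) ^ 2 * (((h + 1) * (k + 1) : ℕ) * x) by
        rw [hc]; push_cast; ring, Real.sqrt_mul (by positivity), Real.sqrt_sq (by positivity)]
    rw [e, hc]
    push_cast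
    field_simp
  rw [h2, h3, h4] at h1
  set S := ∑ h ∈ Finset.range H, dualTerm x ((h + 1) * (k + 1))
  field_simp
  linarith

/-- The continuous periodic function `({y} - {y}²) / 2`, a primitive of `-ψ`. -/
noncomputable def fractQuad (y : ℝ) : ℝ := (Int.fract y - Int.fract y ^ 2) / 2

theorem hasSum_inv_succ_sq : HasSum (fun h : ℕ => 1 / ((h : ℝ) + 1) ^ 2) (Real.pi ^ 2 / 6) := by
  have h := (hasSum_nat_add_iff' 1).2 hasSum_zeta_two
  simpa using h

/-- This is the Fourier series of the Bernoulli polynomial B₂ at the fractional part, subtracted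
from its value at 0. -/
theorem hasSum_fractQuad (y : ℝ) :
    HasSum (fun h : ℕ => (1 - Real.cos (2 * Real.pi * (h + 1) * y)) /
      (2 * Real.pi ^ 2 * ((h : ℝ) + 1) ^ 2)) (fractQuad y) := by
  have h0 : Int.fract y ∈ Icc (0 : ℝ) 1 := ⟨Int.fract_nonneg y, (Int.fract_lt_one y).le⟩
  have h1 := (hasSum_nat_add_iff' 1).2 (hasSum_one_div_nat_pow_mul_cos one_ne_zero h0)
  have hB : Polynomial.eval (Int.fract y) (Polynomial.map (algebraMap ℚ ℝ)
      (Polynomial.bernoulli (2 * 1))) = Int.fract y ^ 2 - Int.fract y + 1 / 6 := by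
    simp [Polynomial.bernoulli_def, Finset.sum_range_succ, bernoulli_two, bernoulli_one,
      bernoulli_zero]
    ring
  rw [hB] at h1
  have h2 := (hasSum_inv_succ_sq.sub h1).mul_left (1 / (2 * Real.pi ^ 2))
  have hpi := Real.pi_ne_zero
  convert! h2 using 1
  · ext h
    have e : Real.cos (2 * Real.pi * ((h + 1 : ℕ) : ℝ) * Int.fract y) =
        Real.cos (2 * Real.pi * (h + 1) * y) := by
      rw [← Real.cos_sub_int_mul_two_pi (2 * Real.pi * (h + 1) * y) ((h + 1) * ⌊y⌋)]
      congr 1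
      rw [Int.fract]
      push_cast
      ring
    rw [e]
    push_cast
    field_simp
  · simp only [fractQuad, Finset.sum_range_one]
    norm_num
    field_simp
    ring

theorem sqrt_pi_le_two : Real.sqrt Real.pi ≤ 2 := by
  rw [Real.sqrt_le_left (by norm_num)]
  linarith [Real.pi_lt_four]

theorem abs_Phi_le {l : ℝ} (hl : 1 ≤ l) : |Phi l| ≤ 12 / Real.sqrt l := by
  have hl0 : 0 < l := by linarith
  have h1 := abs_Phi_sub_le hl
  have hs : 1 ≤ Real.sqrt l := Real.one_le_sqrt.2 hl
  have h2 : 11 / l ≤ 11 / Real.sqrt l := by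
    gcongr
    rw [Real.sqrt_le_left hl0.le]
    nlinarith
  have h3 : |Real.sqrt Real.pi / (2 * Real.sqrt l) * Real.sin (2 * l - Real.pi / 4)| ≤
      1 / Real.sqrt l := by
    rw [abs_mul, abs_of_nonneg (by positivity)]
    calc _ ≤ 2 / (2 * Real.sqrt l) * 1 := by
          gcongr
          · exact sqrt_pi_le_two
          · exact Real.abs_sin_le_one _
      _ = _ := by field_simp
  have h4 : |Phi l| ≤ |Phi l - Real.sqrt Real.pi / (2 * Real.sqrt l) *
      Real.sin (2 * l - Real.pi / 4)| + |Real.sqrt Real.pi / (2 * Real.sqrt l) *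
      Real.sin (2 * l - Real.pi / 4)| := by
    have := abs_add_le (Phi l - Real.sqrt Real.pi / (2 * Real.sqrt l) *
      Real.sin (2 * l - Real.pi / 4)) (Real.sqrt Real.pi / (2 * Real.sqrt l) *
      Real.sin (2 * l - Real.pi / 4))
    rwa [sub_add_cancel] at this
  have e : 12 / Real.sqrt l = 11 / Real.sqrt l + 1 / Real.sqrt l := by ring
  linarith

theorem one_le_two_pi_mul_sqrt {x : ℝ} (hx : 1 ≤ x) {n : ℕ} (hn : 1 ≤ n) :
    Real.sqrt (n * x) ≤ 2 * Real.pi * Real.sqrt (n * x) ∧ 1 ≤ Real.sqrt (n * x) := by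
  have hn' : (1 : ℝ) ≤ n := by exact_mod_cast hn
  have h1 : 1 ≤ Real.sqrt (n * x) := Real.one_le_sqrt.2 (by nlinarith)
  exact ⟨by nlinarith [Real.pi_gt_three], h1⟩

theorem sqrt_sqrt_eq {y : ℝ} (hy : 0 ≤ y) : Real.sqrt (Real.sqrt y) = y ^ (1 / 4 : ℝ) := by
  rw [Real.sqrt_eq_rpow, Real.sqrt_eq_rpow, ← Real.rpow_mul hy]
  norm_num

/-- With l = 2π√(nx) ≥ √n, the bound `Phi` = O(l^(-1/2)) gains n^(-1/4) over the prefactor 1/n. The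
exponent 5/4 > 1 makes the double sum over h and k absolutely convergent. -/
theorem abs_dualTerm_le {x : ℝ} (hx : 1 ≤ x) {n : ℕ} (hn : 1 ≤ n) :
    |dualTerm x n| ≤ 2 * x * ((n : ℝ) ^ (5 / 4 : ℝ))⁻¹ := by
  have hn' : (1 : ℝ) ≤ n := by exact_mod_cast hn
  have hn0 : (0 : ℝ) < n := by linarith
  have hx0 : 0 < x := by linarith
  obtain ⟨h1, h2⟩ := one_le_two_pi_mul_sqrt hx hn
  have h3 := abs_Phi_le (h2.trans h1)
  have h4 : (n : ℝ) ^ (1 / 4 : ℝ) ≤ Real.sqrt (2 * Real.pi * Real.sqrt (n * x)) := by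
    rw [← sqrt_sqrt_eq hn0.le]
    refine Real.sqrt_le_sqrt (le_trans (Real.sqrt_le_sqrt ?_) h1)
    nlinarith
  have hp : 0 < (n : ℝ) ^ (1 / 4 : ℝ) := Real.rpow_pos_of_pos hn0 _
  have hpi : 9 ≤ Real.pi ^ 2 := by nlinarith [Real.pi_gt_three]
  have e : (n : ℝ) ^ (5 / 4 : ℝ) = n * (n : ℝ) ^ (1 / 4 : ℝ) := by
    rw [← Real.rpow_one_add' hn0.le (by norm_num)]; norm_num
  rw [dualTerm, abs_mul, abs_of_pos (by positivity), e]
  calc _ ≤ x / (9 * n) * (12 / (n : ℝ) ^ (1 / 4 : ℝ)) := by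
        gcongr
        exact h3.trans (by gcongr)
    _ = 12 / 9 * x * (n * (n : ℝ) ^ (1 / 4 : ℝ))⁻¹ := by field_simp
    _ ≤ _ := by gcongr; norm_num

theorem summable_mul_rpow_inv {s : ℝ} (hs : 1 < s) :
    Summable fun p : ℕ × ℕ => ((((p.1 + 1) * (p.2 + 1) : ℕ) : ℝ) ^ s)⁻¹ := by
  have h1 : Summable fun n : ℕ => (((n + 1 : ℕ) : ℝ) ^ s)⁻¹ :=
    (summable_nat_add_iff 1).2 (Real.summable_nat_rpow_inv.2 hs)
  refine (h1.mul_of_nonneg h1 (fun n => by simp only [Pi.zero_apply]; positivity)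
    (fun n => by simp only [Pi.zero_apply]; positivity)).congr fun p => ?_
  rw [Nat.cast_mul, Real.mul_rpow (Nat.cast_nonneg _) (Nat.cast_nonneg _), mul_inv]

theorem summable_dualTerm {x : ℝ} (hx : 1 ≤ x) :
    Summable fun p : ℕ × ℕ => dualTerm x ((p.1 + 1) * (p.2 + 1)) :=
  Summable.of_norm_bounded ((summable_mul_rpow_inv (by norm_num : (1 : ℝ) < 5 / 4)).mul_left (2 * x))
    fun _ => abs_dualTerm_le hx (Nat.mul_pos (Nat.succ_pos _) (Nat.succ_pos _))

/-- Grouping a double sum over `h, k ≥ 1` according to the product `h * k`. -/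
theorem hasSum_d_mul {F : ℕ → ℝ} (hF : Summable fun p : ℕ × ℕ => F ((p.1 + 1) * (p.2 + 1))) :
    HasSum (fun n => (d n : ℝ) * F n) (∑' p : ℕ × ℕ, F ((p.1 + 1) * (p.2 + 1))) := by
  have h := hF.hasSum.tsum_fiberwise fun p : ℕ × ℕ => (p.1 + 1) * (p.2 + 1)
  convert! h using 1
  ext n
  have h1 : ∀ b : ↑((fun p : ℕ × ℕ => (p.1 + 1) * (p.2 + 1)) ⁻¹' {n}),
      F ((b.1.1 + 1) * (b.1.2 + 1)) = F n := fun b => congrArg F b.2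
  simp_rw [h1]
  rw [tsum_const, nsmul_eq_mul]
  congr 2
  have hcard : d n = n.divisorsAntidiagonal.card := by
    rw [d, ← Nat.map_div_right_divisors, Finset.card_map]
  have hcard' : n.divisorsAntidiagonal.card =
      Nat.card (n.divisorsAntidiagonal : Set (ℕ × ℕ)) := by
    rw [Nat.card_coe_set_eq, Set.ncard_coe_finset]
  rw [hcard, hcard']
  refine Nat.card_congr ⟨fun q => ⟨(q.1.1 - 1, q.1.2 - 1), ?_⟩,
    fun p => ⟨(p.1.1 + 1, p.1.2 + 1), ?_⟩, fun q => ?_, fun p => ?_⟩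
  · have hq := Nat.mem_divisorsAntidiagonal.1 (Finset.mem_coe.1 q.2)
    have h1 : q.1.1 ≠ 0 := by rintro h0; rw [h0] at hq; omega
    have h2 : q.1.2 ≠ 0 := by rintro h0; rw [h0] at hq; omega
    simp only [mem_preimage, mem_singleton_iff]
    rw [Nat.sub_add_cancel (Nat.pos_of_ne_zero h1), Nat.sub_add_cancel (Nat.pos_of_ne_zero h2)]
    exact hq.1
  · have hp : (p.1.1 + 1) * (p.1.2 + 1) = n := p.2
    rw [Finset.mem_coe, Nat.mem_divisorsAntidiagonal]
    exact ⟨hp, by rw [← hp]; positivity⟩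
  · have hq := Nat.mem_divisorsAntidiagonal.1 (Finset.mem_coe.1 q.2)
    have h1 : q.1.1 ≠ 0 := by rintro h0; rw [h0] at hq; omega
    have h2 : q.1.2 ≠ 0 := by rintro h0; rw [h0] at hq; omega
    ext
    · exact Nat.sub_add_cancel (Nat.pos_of_ne_zero h1)
    · exact Nat.sub_add_cancel (Nat.pos_of_ne_zero h2)
  · ext <;> simp

/-- Truncating at H keeps the function continuous and the h-sum finite, so Poisson summation in k
applies directly. The k-th tail is at most 1/(4π²(k + 1)²), independently of H, so the bound
survives the limit H → ∞. -/
theorem abs_trapezoid_gPart_sub_le {x : ℝ} (hx : 1 ≤ x) (H : ℕ) {M : ℕ} (hM : 2 * x ≤ M) :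
    |((∑ m ∈ Finset.range M, (gPart x H m + gPart x H (m + 1 : ℕ)) / 2) -
      ∫ u in (0 : ℝ)..M, gPart x H u) -
      ∑ h ∈ Finset.range H, ∑' k : ℕ, dualTerm x ((h + 1) * (k + 1))| ≤ 1 := by
  have hx0 : 0 < x := by linarith
  have hM0 : (0 : ℝ) < M := by linarith
  set err : ℕ → ℝ := fun k => 1 / (2 * Real.pi * (k + 1 : ℕ)) *
    ∫ u in Ioi (M : ℝ), gPartDeriv x H u * Real.sin (2 * Real.pi * (k + 1 : ℕ) * u) with herr
  have hbound : ∀ k, ‖err k‖ ≤ 1 / (4 * Real.pi ^ 2) * (1 / ((k : ℝ) + 1) ^ 2) := by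
    intro k
    have hc : 0 < 2 * Real.pi * ((k + 1 : ℕ) : ℝ) := by positivity
    have h1 := abs_integral_gPartDeriv_tail_le hx0 H hc hM
    rw [herr, Real.norm_eq_abs, abs_mul, abs_of_pos (by positivity)]
    calc _ ≤ 1 / (2 * Real.pi * ((k + 1 : ℕ) : ℝ)) * (M / (2 * Real.pi * ((k + 1 : ℕ) : ℝ) * M)) := by
          gcongr
          exact h1.trans (by gcongr)
      _ = _ := by push_cast; field_simp; norm_num
  have herrs : Summable err := Summable.of_norm_bounded
    (hasSum_inv_succ_sq.summable.mul_left _) hbound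
  have hdual : ∀ h, Summable fun k : ℕ => dualTerm x ((h + 1) * (k + 1)) :=
    fun h => (summable_dualTerm hx).prod_factor h
  have hterm : ∀ k : ℕ, 2 * ∫ u in (0 : ℝ)..M, gPart x H u *
      Real.cos (2 * Real.pi * (k + 1 : ℕ) * u) =
      (∑ h ∈ Finset.range H, dualTerm x ((h + 1) * (k + 1))) + 2 * err k := by
    intro k
    rw [integral_gPart_mul_cos hx0]
    ring
  have hsum : HasSum (fun k => (∑ h ∈ Finset.range H, dualTerm x ((h + 1) * (k + 1))) + 2 * err k)
      ((∑ h ∈ Finset.range H, ∑' k : ℕ, dualTerm x ((h + 1) * (k + 1))) + 2 * ∑' k, err k) :=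
    (hasSum_sum fun h _ => (hdual h).hasSum).add (herrs.hasSum.mul_left 2)
  have hP := hasSum_integral_mul_cos (continuous_gPart x H) M (by
    rw [← summable_nat_add_iff 1]
    refine (hsum.summable.mul_left (1 / 2)).congr fun k => ?_
    rw [← hterm]; ring)
  simp_rw [hterm] at hP
  rw [hP.unique hsum, add_sub_cancel_left]
  have h2 : ‖∑' k, err k‖ ≤ 1 / (4 * Real.pi ^ 2) * (Real.pi ^ 2 / 6) :=
    tsum_of_norm_bounded (hasSum_inv_succ_sq.mul_left _) hbound
  rw [abs_mul, abs_two]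
  have : 1 / (4 * Real.pi ^ 2) * (Real.pi ^ 2 / 6) = 1 / 24 := by
    have := Real.pi_ne_zero
    field_simp
    norm_num
  rw [this, Real.norm_eq_abs] at h2
  linarith

theorem tendsto_gPart (x u : ℝ) :
    Tendsto (fun H => gPart x H u) atTop (𝓝 (u * fractQuad (x / u))) := by
  have h := ((hasSum_fractQuad (x / u)).mul_left u).tendsto_sum_nat
  refine h.congr fun H => Finset.sum_congr rfl fun k _ => ?_
  rw [mul_div_assoc (2 * Real.pi * ((k : ℝ) + 1)) x u]
  ring

theorem abs_gPart_le (x : ℝ) (H : ℕ) (u : ℝ) : |gPart x H u| ≤ |u| := by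
  have hpi := Real.pi_pos
  calc |gPart x H u| ≤ ∑ h ∈ Finset.range H, |u| / Real.pi ^ 2 * (1 / ((h : ℝ) + 1) ^ 2) := by
        refine (Finset.abs_sum_le_sum_abs _ _).trans (Finset.sum_le_sum fun h _ => ?_)
        rw [abs_div, abs_mul, abs_of_pos (by positivity : 0 < 2 * Real.pi ^ 2 * ((h : ℝ) + 1) ^ 2)]
        have : |1 - Real.cos (2 * Real.pi * (h + 1) * x / u)| ≤ 2 := by
          rw [abs_le]
          constructor <;> linarith [Real.neg_one_le_cos (2 * Real.pi * (h + 1) * x / u),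
            Real.cos_le_one (2 * Real.pi * (h + 1) * x / u)]
        calc _ ≤ |u| * 2 / (2 * Real.pi ^ 2 * ((h : ℝ) + 1) ^ 2) := by gcongr
          _ = _ := by field_simp
    _ ≤ |u| / Real.pi ^ 2 * (Real.pi ^ 2 / 6) := by
        rw [← Finset.mul_sum]
        gcongr
        exact sum_le_hasSum _ (fun _ _ => by positivity) hasSum_inv_succ_sq
    _ = |u| / 6 := by field_simp
    _ ≤ |u| := by linarith [abs_nonneg u]

theorem abs_trapezoid_sub_le {x : ℝ} (hx : 1 ≤ x) {M : ℕ} (hM : 2 * x ≤ M) :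
    |((∑ m ∈ Finset.range M, ((m : ℝ) * fractQuad (x / m) +
        ((m + 1 : ℕ) : ℝ) * fractQuad (x / ((m + 1 : ℕ) : ℝ))) / 2) -
      ∫ u in (0 : ℝ)..M, u * fractQuad (x / u)) -
      ∑' p : ℕ × ℕ, dualTerm x ((p.1 + 1) * (p.2 + 1))| ≤ 1 := by
  have h1 : Tendsto (fun H => ∑ m ∈ Finset.range M, (gPart x H m + gPart x H (m + 1 : ℕ)) / 2) atTop
      (𝓝 (∑ m ∈ Finset.range M, ((m : ℝ) * fractQuad (x / m) +
        ((m + 1 : ℕ) : ℝ) * fractQuad (x / ((m + 1 : ℕ) : ℝ))) / 2)) :=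
    tendsto_finsetSum _ fun m _ => ((tendsto_gPart x _).add (tendsto_gPart x _)).div_const 2
  have h2 : Tendsto (fun H => ∫ u in (0 : ℝ)..M, gPart x H u) atTop
      (𝓝 (∫ u in (0 : ℝ)..M, u * fractQuad (x / u))) := by
    refine intervalIntegral.tendsto_integral_filter_of_dominated_convergence (fun u => |u|)
      (Eventually.of_forall fun H => (continuous_gPart x H).aestronglyMeasurable)
      (Eventually.of_forall fun H => Eventually.of_forall fun u _ => abs_gPart_le x H u)
      (Continuous.intervalIntegrable (by fun_prop) _ _)
      (Eventually.of_forall fun u _ => tendsto_gPart x u)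
  have h3 : Tendsto (fun H => ∑ h ∈ Finset.range H, ∑' k : ℕ, dualTerm x ((h + 1) * (k + 1))) atTop
      (𝓝 (∑' p : ℕ × ℕ, dualTerm x ((p.1 + 1) * (p.2 + 1)))) := by
    rw [(summable_dualTerm hx).tsum_prod]
    exact (summable_dualTerm hx).prod.hasSum.tendsto_sum_nat
  exact le_of_tendsto ((h1.sub h2).sub h3).abs
    (Eventually.of_forall fun H => abs_trapezoid_gPart_sub_le hx H hM)

/-- The O(1/l) error in `Phi` with l = 2π√(nx), times x/(π²n), is O(√x n^(-3/2)). This remains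
summable against d(n), so the total error is O(√x). -/
theorem abs_dualTerm_sub_le {x : ℝ} (hx : 1 ≤ x) {n : ℕ} (hn : 1 ≤ n) :
    |dualTerm x n - 1 / (2 * Real.sqrt 2 * Real.pi ^ 2) * x ^ (3 / 4 : ℝ) *
      (1 / (n : ℝ) ^ (5 / 4 : ℝ) * Real.sin (4 * Real.pi * Real.sqrt ((n : ℝ) * x) - Real.pi / 4))| ≤
      Real.sqrt x * ((n : ℝ) ^ (3 / 2 : ℝ))⁻¹ := by
  have hn' : (1 : ℝ) ≤ n := by exact_mod_cast hn
  have hn0 : (0 : ℝ) < n := by linarith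
  have hx0 : 0 < x := by linarith
  obtain ⟨h1, h2⟩ := one_le_two_pi_mul_sqrt hx hn
  have h3 := abs_Phi_sub_le (h2.trans h1)
  have hpi := Real.pi_pos
  set l := 2 * Real.pi * Real.sqrt (n * x) with hl
  have e1 : 4 * Real.pi * Real.sqrt ((n : ℝ) * x) - Real.pi / 4 = 2 * l - Real.pi / 4 := by
    rw [hl]; ring
  have hsx : 0 < Real.sqrt x := Real.sqrt_pos.2 hx0
  have hsn : 0 < Real.sqrt n := Real.sqrt_pos.2 hn0
  have hn4 : 0 < (n : ℝ) ^ (1 / 4 : ℝ) := Real.rpow_pos_of_pos hn0 _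
  have hx4 : 0 < x ^ (1 / 4 : ℝ) := Real.rpow_pos_of_pos hx0 _
  have e2 : Real.sqrt l = Real.sqrt 2 * Real.sqrt Real.pi * ((n : ℝ) ^ (1 / 4 : ℝ) *
      x ^ (1 / 4 : ℝ)) := by
    rw [hl, Real.sqrt_mul (by positivity), Real.sqrt_mul (by positivity),
      sqrt_sqrt_eq (by positivity), Real.mul_rpow hn0.le hx0.le]
  have e3 : (n : ℝ) ^ (5 / 4 : ℝ) = n * (n : ℝ) ^ (1 / 4 : ℝ) := by
    rw [← Real.rpow_one_add' hn0.le (by norm_num)]; norm_num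
  have e4 : x ^ (3 / 4 : ℝ) * x ^ (1 / 4 : ℝ) = x := by
    rw [← Real.rpow_add hx0]; norm_num
  have e5 : (n : ℝ) ^ (3 / 2 : ℝ) = n * Real.sqrt n := by
    rw [Real.sqrt_eq_rpow, ← Real.rpow_one_add' hn0.le (by norm_num)]; norm_num
  have e6 : 1 / (2 * Real.sqrt 2 * Real.pi ^ 2) * x ^ (3 / 4 : ℝ) *
      (1 / (n : ℝ) ^ (5 / 4 : ℝ) * Real.sin (2 * l - Real.pi / 4)) =
      x / (Real.pi ^ 2 * n) * (Real.sqrt Real.pi / (2 * Real.sqrt l) *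
        Real.sin (2 * l - Real.pi / 4)) := by
    have hsp : 0 < Real.sqrt Real.pi := Real.sqrt_pos.2 hpi
    rw [e2, e3]
    nth_rewrite 2 [← e4]
    field_simp
  rw [e1, e6, dualTerm, ← hl, ← mul_sub, abs_mul, abs_of_pos (by positivity), e5]
  calc _ ≤ x / (Real.pi ^ 2 * n) * (11 / l) := by gcongr
    _ = 11 / (2 * Real.pi ^ 3) * (x / (n * Real.sqrt (n * x))) := by rw [hl]; field_simp
    _ = 11 / (2 * Real.pi ^ 3) * (Real.sqrt x * (n * Real.sqrt n)⁻¹) := by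
        congr 1
        rw [Real.sqrt_mul hn0.le]
        field_simp
        rw [Real.sq_sqrt hx0.le]
    _ ≤ 1 * (Real.sqrt x * (n * Real.sqrt n)⁻¹) := by
        gcongr
        rw [div_le_one (by positivity)]
        have : (3 : ℝ) ^ 3 ≤ Real.pi ^ 3 := by gcongr; exact Real.pi_gt_three.le
        linarith
    _ = _ := one_mul _

theorem summable_d_mul_rpow_inv {s : ℝ} (hs : 1 < s) :
    Summable fun n : ℕ => (d n : ℝ) * ((n : ℝ) ^ s)⁻¹ :=
  (hasSum_d_mul (F := fun n => ((n : ℝ) ^ s)⁻¹) (summable_mul_rpow_inv hs)).summable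

theorem abs_GTerm_le (x : ℝ) (n : ℕ) : |GTerm x n| ≤ (d n : ℝ) * ((n : ℝ) ^ (5 / 4 : ℝ))⁻¹ := by
  rw [GTerm, abs_mul, abs_of_nonneg (by positivity), div_eq_mul_inv]
  exact mul_le_of_le_one_right (by positivity) (Real.abs_sin_le_one _)

theorem summable_GTerm (x : ℝ) : Summable (GTerm x) :=
  Summable.of_norm_bounded (summable_d_mul_rpow_inv (by norm_num : (1 : ℝ) < 5 / 4))
    fun n => abs_GTerm_le x n

theorem exists_abs_tsum_dualTerm_sub_G_le : ∃ C : ℝ, ∀ x : ℝ, 1 ≤ x →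
    |(∑' p : ℕ × ℕ, dualTerm x ((p.1 + 1) * (p.2 + 1))) - G x| ≤ C * Real.sqrt x := by
  refine ⟨∑' n : ℕ, (d n : ℝ) * ((n : ℝ) ^ (3 / 2 : ℝ))⁻¹, fun x hx => ?_⟩
  have h1 := hasSum_d_mul (summable_dualTerm hx)
  have h2 := (summable_GTerm x).hasSum.mul_left
    (1 / (2 * Real.sqrt 2 * Real.pi ^ 2) * x ^ (3 / 4 : ℝ))
  rw [← h1.tsum_eq, G, ← h2.tsum_eq, ← (h1.summable.tsum_sub h2.summable), ← Real.norm_eq_abs]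
  refine tsum_of_norm_bounded
    ((summable_d_mul_rpow_inv (by norm_num : (1 : ℝ) < 3 / 2)).hasSum.mul_right _) fun n => ?_
  rcases Nat.eq_zero_or_pos n with rfl | hn
  · simp [d, GTerm]
  · have h3 := abs_dualTerm_sub_le hx hn
    have e : (d n : ℝ) * dualTerm x n - 1 / (2 * Real.sqrt 2 * Real.pi ^ 2) * x ^ (3 / 4 : ℝ) *
        GTerm x n = d n * (dualTerm x n - 1 / (2 * Real.sqrt 2 * Real.pi ^ 2) * x ^ (3 / 4 : ℝ) *
      (1 / (n : ℝ) ^ (5 / 4 : ℝ) *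
        Real.sin (4 * Real.pi * Real.sqrt ((n : ℝ) * x) - Real.pi / 4))) := by
      rw [GTerm]; ring
    rw [e, norm_mul, Real.norm_natCast, Real.norm_eq_abs]
    calc _ ≤ (d n : ℝ) * (Real.sqrt x * ((n : ℝ) ^ (3 / 2 : ℝ))⁻¹) := by gcongr
      _ = _ := by ring

theorem exists_abs_G_le : ∃ C : ℝ, 0 ≤ C ∧ ∀ x : ℝ, 0 ≤ x → |G x| ≤ C * x ^ (3 / 4 : ℝ) := by
  refine ⟨∑' n : ℕ, (d n : ℝ) * ((n : ℝ) ^ (5 / 4 : ℝ))⁻¹, tsum_nonneg fun n => by positivity,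
    fun x hx => ?_⟩
  have h := tsum_of_norm_bounded (f := GTerm x)
    (summable_d_mul_rpow_inv (by norm_num : (1 : ℝ) < 5 / 4)).hasSum
    fun n => abs_GTerm_le x n
  rw [Real.norm_eq_abs] at h
  rw [G, abs_mul, abs_of_nonneg (by positivity), mul_comm (∑' n : ℕ, _)]
  have h1 : 1 / (2 * Real.sqrt 2 * Real.pi ^ 2) ≤ 1 := by
    rw [div_le_one (by positivity)]
    have := Real.one_le_sqrt.2 (one_le_two : (1 : ℝ) ≤ 2)
    have := Real.pi_gt_three
    nlinarith
  calc _ ≤ 1 * x ^ (3 / 4 : ℝ) * ∑' n : ℕ, (d n : ℝ) * ((n : ℝ) ^ (5 / 4 : ℝ))⁻¹ := by gcongr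
    _ = _ := by rw [one_mul]

/-! ### The explicit main terms of Σ d(n)(x - n). -/

theorem fractQuad_eq {y : ℝ} (n : ℕ) (h1 : (n : ℝ) ≤ y) (h2 : y ≤ n + 1) :
    fractQuad y = ((y - n) - (y - n) ^ 2) / 2 := by
  rcases h2.eq_or_lt with h | h
  · have : Int.fract y = 0 := by
      rw [h, show (n : ℝ) + 1 = ((n + 1 : ℕ) : ℝ) by push_cast; ring, Int.fract_natCast]
    rw [fractQuad, this, h]
    ring
  · have : Int.fract y = y - n := by
      rw [Int.fract_eq_iff]
      exact ⟨by linarith, by linarith, n, by push_cast; ring⟩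
    rw [fractQuad, this]

theorem fractQuad_nonneg (y : ℝ) : 0 ≤ fractQuad y := by
  have h1 := Int.fract_nonneg y
  have h2 := (Int.fract_lt_one y).le
  rw [fractQuad]
  nlinarith

theorem fractQuad_le (y : ℝ) : fractQuad y ≤ 1 / 8 := by
  rw [fractQuad]
  nlinarith [sq_nonneg (Int.fract y - 1 / 2)]

theorem measurable_fractQuad : Measurable fractQuad := by
  unfold fractQuad
  exact (measurable_fract.sub (measurable_fract.pow_const 2)).div_const 2

theorem sum_Icc_sub (y : ℝ) (N : ℕ) :
    ∑ l ∈ Finset.Icc 1 N, (y - l) = N * y - N * (N + 1) / 2 := by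
  induction N with
  | zero => simp
  | succ N ih =>
    rw [Finset.sum_Icc_succ_top (by omega), ih]
    push_cast
    ring

theorem sum_Icc_floor_sub {y : ℝ} (hy : 0 ≤ y) :
    ∑ l ∈ Finset.Icc 1 ⌊y⌋₊, (y - l) = y ^ 2 / 2 - y / 2 + fractQuad y := by
  rw [sum_Icc_sub, fractQuad_eq ⌊y⌋₊ (Nat.floor_le hy) (Nat.lt_floor_add_one y).le]
  ring

theorem sum_dvd_eq (f : ℕ → ℝ) (N : ℕ) {m : ℕ} (hm : 1 ≤ m) :
    ∑ n ∈ Finset.Icc 1 N with m ∣ n, f n = ∑ l ∈ Finset.Icc 1 (N / m), f (m * l) := by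
  symm
  refine Finset.sum_nbij' (fun l => m * l) (fun n => n / m) ?_ ?_ ?_ ?_ ?_
  · intro l hl
    rw [Finset.mem_Icc] at hl
    rw [Finset.mem_filter, Finset.mem_Icc]
    refine ⟨⟨Nat.mul_pos hm hl.1, ?_⟩, Dvd.intro l rfl⟩
    calc m * l ≤ m * (N / m) := Nat.mul_le_mul_left m hl.2
      _ ≤ N := Nat.mul_div_le N m
  · intro n hn
    rw [Finset.mem_filter, Finset.mem_Icc] at hn
    rw [Finset.mem_Icc]
    exact ⟨Nat.div_pos (Nat.le_of_dvd hn.1.1 hn.2) hm, Nat.div_le_div_right hn.1.2⟩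
  · intro l _
    exact Nat.mul_div_cancel_left l hm
  · intro n hn
    rw [Finset.mem_filter] at hn
    exact Nat.mul_div_cancel' hn.2
  · intro l _
    rfl

/-- Any M ≥ N is allowed as cutoff because the inner sum is empty when m > N. This freedom is used
later to let M exceed 2x². -/
theorem sum_d_mul_eq (f : ℕ → ℝ) {N M : ℕ} (hNM : N ≤ M) :
    ∑ n ∈ Finset.Icc 1 N, (d n : ℝ) * f n =
      ∑ m ∈ Finset.Icc 1 M, ∑ l ∈ Finset.Icc 1 (N / m), f (m * l) := by
  have h1 : ∀ n ∈ Finset.Icc 1 N, (d n : ℝ) * f n =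
      ∑ m ∈ Finset.Icc 1 M, if m ∣ n then f n else 0 := by
    intro n hn
    rw [Finset.mem_Icc] at hn
    rw [← Finset.sum_filter, Finset.sum_const, nsmul_eq_mul, d]
    congr 3
    ext m
    rw [Nat.mem_divisors, Finset.mem_filter, Finset.mem_Icc]
    constructor
    · rintro ⟨h, _⟩
      have := Nat.le_of_dvd (by omega) h
      exact ⟨⟨Nat.pos_of_dvd_of_pos h (by omega), by omega⟩, h⟩
    · rintro ⟨_, h⟩
      exact ⟨h, by omega⟩
  rw [Finset.sum_congr rfl h1, Finset.sum_comm]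
  refine Finset.sum_congr rfl fun m hm => ?_
  rw [← Finset.sum_filter, sum_dvd_eq f N (Finset.mem_Icc.1 hm).1]

theorem sum_d_mul_sub_eq {x : ℝ} (hx : 0 ≤ x) {M : ℕ} (hM : x ≤ M) :
    ∑ n ∈ Finset.Icc 1 ⌊x⌋₊, (d n : ℝ) * (x - n) =
      ∑ m ∈ Finset.Icc 1 M, (x ^ 2 / 2 * (1 / (m : ℝ)) - x / 2 + m * fractQuad (x / m)) := by
  rw [sum_d_mul_eq (fun n => x - n) (Nat.floor_le_of_le hM)]
  refine Finset.sum_congr rfl fun m hm => ?_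
  have hm0 : (0 : ℝ) < m := by exact_mod_cast (Finset.mem_Icc.1 hm).1
  have h := sum_Icc_floor_sub (div_nonneg hx hm0.le)
  rw [Nat.floor_div_natCast] at h
  calc _ = m * ∑ l ∈ Finset.Icc 1 (⌊x⌋₊ / m), (x / m - l) := by
        rw [Finset.mul_sum]
        refine Finset.sum_congr rfl fun l _ => ?_
        push_cast
        field_simp
    _ = _ := by
        rw [h]
        field_simp

theorem intervalIntegrable_mul_fractQuad (x a b : ℝ) :
    IntervalIntegrable (fun u => u * fractQuad (x / u)) volume a b := by
  have hb : IntervalIntegrable (fun u : ℝ => |u|) volume a b :=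
    Continuous.intervalIntegrable (by fun_prop) _ _
  refine hb.mono_fun ?_ ?_
  · exact (measurable_id.mul
      (measurable_fractQuad.comp (measurable_const.div measurable_id))).aestronglyMeasurable
  · refine Eventually.of_forall fun u => ?_
    beta_reduce
    rw [norm_mul, Real.norm_eq_abs, Real.norm_eq_abs, Real.norm_eq_abs, abs_abs,
      abs_of_nonneg (fractQuad_nonneg _)]
    exact mul_le_of_le_one_right (abs_nonneg u) ((fractQuad_le _).trans (by norm_num))

theorem integral_mul_fractQuad_inv {a b : ℝ} (n : ℕ) (ha : 0 < a) (hab : a ≤ b)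
    (h1 : n * b ≤ 1) (h2 : 1 ≤ (n + 1) * a) :
    ∫ v in a..b, v * fractQuad (1 / v) =
      ((1 + 2 * n) * (b - a) - (n + n ^ 2) * (b ^ 2 - a ^ 2) / 2 - (Real.log b - Real.log a)) / 2 := by
  have hpos : ∀ v ∈ uIcc a b, 0 < v := fun v hv => by
    rw [uIcc_of_le hab] at hv; exact ha.trans_le hv.1
  have e1 : ∫ v in a..b, v * fractQuad (1 / v) =
      ∫ v in a..b, ((1 + 2 * n) - (n + n ^ 2) * v - v⁻¹) / 2 := by
    refine intervalIntegral.integral_congr fun v hv => ?_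
    have hv0 := hpos v hv
    rw [uIcc_of_le hab] at hv
    have h3 : (n : ℝ) ≤ 1 / v := by
      rw [le_div_iff₀ hv0]
      exact (mul_le_mul_of_nonneg_left hv.2 (Nat.cast_nonneg n)).trans h1
    have h4 : 1 / v ≤ n + 1 := by
      rw [div_le_iff₀ hv0]
      exact h2.trans (mul_le_mul_of_nonneg_left hv.1 (by positivity))
    rw [fractQuad_eq n h3 h4]
    field_simp
    ring
  rw [e1, intervalIntegral.integral_eq_sub_of_hasDerivAt
    (f := fun v => ((1 + 2 * n) * v - (n + n ^ 2) * v ^ 2 / 2 - Real.log v) / 2)]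
  · ring
  · intro v hv
    have hv0 := (hpos v hv).ne'
    refine (((((hasDerivAt_id v).const_mul (1 + 2 * (n : ℝ))).sub
      ((((hasDerivAt_id v).pow 2).const_mul ((n : ℝ) + n ^ 2)).div_const 2)).sub
      (Real.hasDerivAt_log hv0)).div_const 2).congr_deriv ?_
    simp only [id]
    push_cast
    ring
  · refine ContinuousOn.intervalIntegrable ?_
    have : ContinuousOn (fun v : ℝ => v⁻¹) (uIcc a b) :=
      continuousOn_id.inv₀ fun v hv => (hpos v hv).ne'
    fun_prop

theorem integral_one_div_nat_one (N : ℕ) :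
    ∫ v in (1 / ((N : ℝ) + 1))..1, v * fractQuad (1 / v) =
      ((harmonic (N + 1) : ℝ) - 1 / 2 - 1 / (2 * ((N : ℝ) + 1)) - Real.log ((N : ℝ) + 1)) / 2 := by
  induction N with
  | zero => simp; norm_num
  | succ N ih =>
    have h0 : (0 : ℝ) < (N : ℝ) + 1 := by positivity
    have h1 : (0 : ℝ) < (N : ℝ) + 1 + 1 := by positivity
    rw [← intervalIntegral.integral_add_adjacent_intervals (b := 1 / ((N : ℝ) + 1))
      (intervalIntegrable_mul_fractQuad _ _ _) (intervalIntegrable_mul_fractQuad _ _ _), ih,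
      integral_mul_fractQuad_inv (N + 1) (by positivity) (by push_cast; gcongr; linarith)
      (by push_cast; field_simp; rfl) (by push_cast; field_simp; rfl), harmonic_succ (N + 1)]
    push_cast
    rw [one_div, one_div, Real.log_inv, Real.log_inv]
    field_simp
    ring

/-- On [1/(N + 2), 1/(N + 1)] the integer part of 1/v is constant, so the integral down to 1/(N + 1)
is an explicit combination of a harmonic number and a logarithm. Euler's constant appears in the
limit. -/
theorem integral_zero_one_mul_fractQuad :
    ∫ v in (0 : ℝ)..1, v * fractQuad (1 / v) = Real.eulerMascheroniConstant / 2 - 1 / 4 := by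
  have ht0 : Tendsto (fun N : ℕ => 1 / ((N : ℝ) + 1)) atTop (𝓝 0) := tendsto_one_div_add_atTop_nhds_zero_nat
  have h1 : Tendsto (fun N : ℕ => ∫ v in (1 / ((N : ℝ) + 1))..1, v * fractQuad (1 / v)) atTop
      (𝓝 ((Real.eulerMascheroniConstant - 1 / 2 - 0) / 2)) := by
    have h2 := (tendsto_add_atTop_iff_nat 1).2 Real.tendsto_harmonic_sub_log
    refine (((h2.sub_const (1 / 2)).sub (by simpa using ht0.const_mul (1 / 2))).div_const 2).congr
      fun N => ?_
    rw [integral_one_div_nat_one]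
    push_cast
    field_simp
    ring
  have h3 : Tendsto (fun N : ℕ => ∫ v in (1 / ((N : ℝ) + 1))..1, v * fractQuad (1 / v)) atTop
      (𝓝 (∫ v in (0 : ℝ)..1, v * fractQuad (1 / v))) := by
    rw [tendsto_iff_norm_sub_tendsto_zero]
    refine squeeze_zero (fun _ => norm_nonneg _) (fun N => ?_) ht0
    have h5 := intervalIntegral.integral_add_adjacent_intervals (a := 0) (b := 1 / ((N : ℝ) + 1))
      (c := 1) (intervalIntegrable_mul_fractQuad 1 _ _) (intervalIntegrable_mul_fractQuad 1 _ _)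
    rw [norm_sub_rev, ← h5, add_sub_cancel_right]
    have hN : (0 : ℝ) ≤ 1 / ((N : ℝ) + 1) := by positivity
    have hN1 : 1 / ((N : ℝ) + 1) ≤ 1 := by
      rw [div_le_one (by positivity)]; linarith [(Nat.cast_nonneg N : (0 : ℝ) ≤ N)]
    have h4 := intervalIntegral.norm_integral_le_of_norm_le_const (a := 0)
      (b := 1 / ((N : ℝ) + 1)) (f := fun v => v * fractQuad (1 / v)) (C := 1) fun v hv => by
        rw [uIoc_of_le hN] at hv
        rw [Real.norm_eq_abs, abs_mul, abs_of_pos hv.1, abs_of_nonneg (fractQuad_nonneg _)]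
        have := fractQuad_le (1 / v)
        have := fractQuad_nonneg (1 / v)
        nlinarith [hv.1, hv.2]
    rw [sub_zero, one_mul, abs_of_nonneg hN] at h4
    exact h4
  rw [tendsto_nhds_unique h3 h1]
  ring

theorem integral_mul_fractQuad {x B : ℝ} (hx : 0 < x) (hB : x ≤ B) :
    ∫ u in (0 : ℝ)..B, u * fractQuad (x / u) =
      x ^ 2 * (Real.eulerMascheroniConstant / 2 - 3 / 4 + B / (2 * x) -
        (Real.log B - Real.log x) / 2) := by
  have h := intervalIntegral.integral_comp_mul_left (a := 0) (b := B / x)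
    (fun u => u * fractQuad (x / u)) hx.ne'
  have e1 : ∀ v : ℝ, x * v * fractQuad (x / (x * v)) = x * (v * fractQuad (1 / v)) := by
    intro v
    rw [show x / (x * v) = 1 / v by rw [← div_div, div_self hx.ne']]
    ring
  have hB1 : 1 ≤ B / x := (one_le_div hx).2 hB
  simp_rw [e1] at h
  rw [intervalIntegral.integral_const_mul, mul_zero, mul_div_cancel₀ _ hx.ne', smul_eq_mul,
    ← intervalIntegral.integral_add_adjacent_intervals (b := 1)
      (intervalIntegrable_mul_fractQuad _ _ _) (intervalIntegrable_mul_fractQuad _ _ _),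
    integral_zero_one_mul_fractQuad, integral_mul_fractQuad_inv 0 one_pos hB1 (by simp) (by simp),
    Real.log_div (by linarith) hx.ne'] at h
  rw [← mul_inv_cancel_left₀ hx.ne' (∫ u in (0 : ℝ)..B, u * fractQuad (x / u)), ← h]
  simp only [Nat.cast_zero, Real.log_one]
  field_simp
  ring

theorem abs_harmonic_sub_log_sub_le {M : ℕ} (hM : 1 ≤ M) :
    |(harmonic M : ℝ) - Real.log M - Real.eulerMascheroniConstant| ≤ 1 / M := by
  have hM0 : (0 : ℝ) < M := by exact_mod_cast hM
  have h1 := Real.eulerMascheroniSeq_lt_eulerMascheroniConstant M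
  have h2 := Real.eulerMascheroniConstant_lt_eulerMascheroniSeq' M
  rw [Real.eulerMascheroniSeq] at h1
  rw [Real.eulerMascheroniSeq', if_neg (by omega)] at h2
  have h3 : Real.log ((M : ℝ) + 1) - Real.log M ≤ 1 / M := by
    rw [← Real.log_div (by positivity) hM0.ne']
    refine (Real.log_le_sub_one_of_pos (by positivity)).trans (le_of_eq ?_)
    field_simp
    ring
  rw [abs_le]
  constructor <;> linarith [one_div_pos.2 hM0]

/-- The M-dependent parts of the harmonic sum and of ∫_0^M u `fractQuad`(x/u) du cancel up to O(1).
The secondary term x/4 is the half-weight that the trapezoidal rule gives to the endpoint u = M. -/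
theorem abs_sum_d_mul_sub_le {x : ℝ} (hx : 1 ≤ x) :
    |(∑ n ∈ Finset.Icc 1 ⌊x⌋₊, (d n : ℝ) * (x - n)) -
      (x ^ 2 / 2 * Real.log x + (Real.eulerMascheroniConstant - 3 / 4) * x ^ 2 + x / 4 +
        ∑' p : ℕ × ℕ, dualTerm x ((p.1 + 1) * (p.2 + 1)))| ≤ 2 := by
  have hx0 : 0 < x := by linarith
  -- This size makes x²/(2M) ≤ 1/4 and x²/(4M) ≤ 1/8, bounding the harmonic-number error and the
  -- leftover of the endpoint term; it also gives M ≥ 2x since x ≥ 1.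
  obtain ⟨M, hM⟩ := exists_nat_ge (2 * x ^ 2)
  have hM2 : 2 * x ≤ M := le_trans (by nlinarith) hM
  have hMx : x ≤ M := by linarith
  have hM0 : (0 : ℝ) < M := by linarith
  have hM1 : 1 ≤ M := by exact_mod_cast hM0
  have h1 := abs_trapezoid_sub_le hx hM2
  have h2 := abs_harmonic_sub_log_sub_le hM1
  have htrap : ∀ (g : ℕ → ℝ) (N : ℕ), g 0 = 0 → ∑ m ∈ Finset.range N, (g m + g (m + 1)) / 2 =
      (∑ m ∈ Finset.Icc 1 N, g m) - g N / 2 := by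
    intro g N hg
    induction N with
    | zero => simp [hg]
    | succ N ih =>
      rw [Finset.sum_range_succ, ih, Finset.sum_Icc_succ_top (by omega)]
      ring
  have hgM : fractQuad (x / M) = (x / M - (x / M) ^ 2) / 2 := by
    rw [fractQuad_eq 0 (by simp; positivity)
      (by rw [div_le_iff₀ hM0]; push_cast; linarith)]
    simp
  rw [htrap (fun m => (m : ℝ) * fractQuad (x / m)) M (by simp), hgM,
    integral_mul_fractQuad hx0 hMx] at h1
  rw [sum_d_mul_sub_eq hx0.le hMx, Finset.sum_add_distrib, Finset.sum_sub_distrib, ← Finset.mul_sum]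
  have hH : ∑ m ∈ Finset.Icc 1 M, 1 / (m : ℝ) = harmonic M := by
    rw [harmonic_eq_sum_Icc]
    push_cast
    simp
  rw [hH, Finset.sum_const, Nat.card_Icc, nsmul_eq_mul, Nat.add_sub_cancel]
  set V := ∑' p : ℕ × ℕ, dualTerm x ((p.1 + 1) * (p.2 + 1))
  set S := ∑ m ∈ Finset.Icc 1 M, (m : ℝ) * fractQuad (x / m)
  set h := (harmonic M : ℝ)
  set γ := Real.eulerMascheroniConstant
  have h3 : |x ^ 2 / 2 * (h - Real.log M - γ)| ≤ 1 / 4 := by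
    rw [abs_mul, abs_of_pos (by positivity)]
    calc _ ≤ x ^ 2 / 2 * (1 / M) := by gcongr
      _ = (2 * x ^ 2) / M / 4 := by ring
      _ ≤ 1 / 4 := by
        gcongr
        exact (div_le_one hM0).2 hM
  have h4 : 0 ≤ x ^ 2 / (4 * M) ∧ x ^ 2 / (4 * M) ≤ 1 / 8 := by
    refine ⟨by positivity, ?_⟩
    rw [div_le_iff₀ (by positivity)]; linarith
  have e : x ^ 2 / 2 * h - M * (x / 2) + S -
      (x ^ 2 / 2 * Real.log x + (γ - 3 / 4) * x ^ 2 + x / 4 + V) =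
      (S - M * ((x / M - (x / M) ^ 2) / 2) / 2 - x ^ 2 * (γ / 2 - 3 / 4 + M / (2 * x) -
        (Real.log M - Real.log x) / 2) - V) + x ^ 2 / 2 * (h - Real.log M - γ) - x ^ 2 / (4 * M) := by
    field_simp
    ring
  rw [e]
  rw [abs_le] at h1 h3 ⊢
  constructor <;> linarith [h1.1, h1.2, h3.1, h3.2, h4.1, h4.2]

/-! ### The integral of `Delta`. -/

theorem monotone_D : Monotone fun t : ℝ => (D t : ℝ) := fun _ _ h =>
  Nat.cast_le.2 (Finset.sum_le_sum_of_subset (Finset.Icc_subset_Icc_right (Nat.floor_mono h)))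

/-- Abel summation with the weight t, using d(0) = 0 to discard the index 0. -/
theorem integral_D {x : ℝ} (hx : 1 ≤ x) :
    ∫ t in (1 : ℝ)..x, (D t : ℝ) = ∑ n ∈ Finset.Icc 1 ⌊x⌋₊, (d n : ℝ) * (x - n) := by
  have h := sum_mul_eq_sub_integral_mul₀ (fun n => (d n : ℝ)) (f := id) (by simp [d]) x
    (fun t _ => differentiableAt_id) (by simp [integrableOn_const_iff])
  have h0 : ∀ (g : ℕ → ℝ) (N : ℕ), g 0 = 0 → ∑ k ∈ Finset.Icc 0 N, g k = ∑ k ∈ Finset.Icc 1 N, g k := by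
    intro g N hg
    rw [← Finset.sum_subset (Finset.Icc_subset_Icc_left (Nat.zero_le 1))]
    intro k hk hk'
    rw [Finset.mem_Icc] at hk hk'
    have : k = 0 := by omega
    rw [this, hg]
  have hd0 : (d 0 : ℝ) = 0 := by simp [d]
  simp only [id, deriv_id', one_mul] at h
  rw [h0 _ _ (by simp)] at h
  simp_rw [fun N => h0 (fun n => (d n : ℝ)) N hd0] at h
  have hD : ∀ t : ℝ, (D t : ℝ) = ∑ k ∈ Finset.Icc 1 ⌊t⌋₊, (d k : ℝ) := fun t => by
    rw [D]; push_cast; rfl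
  simp_rw [hD]
  rw [intervalIntegral.integral_of_le hx]
  have e : ∑ n ∈ Finset.Icc 1 ⌊x⌋₊, (d n : ℝ) * (x - n) =
      x * ∑ n ∈ Finset.Icc 1 ⌊x⌋₊, (d n : ℝ) - ∑ n ∈ Finset.Icc 1 ⌊x⌋₊, (n : ℝ) * d n := by
    rw [Finset.mul_sum, ← Finset.sum_sub_distrib]
    exact Finset.sum_congr rfl fun n _ => by ring
  rw [e, h]
  ring

/-- The smooth main term in the Dirichlet divisor problem. -/
noncomputable def mainTerm (t : ℝ) : ℝ :=
  t * Real.log t + (2 * Real.eulerMascheroniConstant - 1) * t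

theorem Delta_eq (t : ℝ) : Delta t = D t - mainTerm t := rfl

theorem continuous_mainTerm : Continuous mainTerm := by
  unfold mainTerm
  exact Real.continuous_mul_log.add (continuous_const.mul continuous_id)

theorem hasDerivAt_mainTerm {t : ℝ} (ht : t ≠ 0) :
    HasDerivAt mainTerm (Real.log t + 2 * Real.eulerMascheroniConstant) t := by
  refine (((hasDerivAt_id t).mul (Real.hasDerivAt_log ht)).add
    ((hasDerivAt_id t).const_mul (2 * Real.eulerMascheroniConstant - 1))).congr_deriv ?_
  simp only [id]
  field_simp
  ring

theorem intervalIntegrable_Delta (a b : ℝ) : IntervalIntegrable Delta volume a b :=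
  monotone_D.intervalIntegrable.sub (continuous_mainTerm.intervalIntegrable a b)

theorem integral_mainTerm {x : ℝ} (hx : 1 ≤ x) :
    ∫ t in (1 : ℝ)..x, mainTerm t = x ^ 2 / 2 * Real.log x +
      (Real.eulerMascheroniConstant - 3 / 4) * x ^ 2 - (Real.eulerMascheroniConstant - 3 / 4) := by
  rw [intervalIntegral.integral_eq_sub_of_hasDerivAt
    (f := fun t => t ^ 2 / 2 * Real.log t + (Real.eulerMascheroniConstant - 3 / 4) * t ^ 2)
    (fun t ht => ?_) (continuous_mainTerm.intervalIntegrable _ _)]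
  · simp
  · rw [uIcc_of_le hx] at ht
    have ht0 : t ≠ 0 := by linarith [ht.1]
    refine (((((hasDerivAt_id t).pow 2).div_const 2).mul (Real.hasDerivAt_log ht0)).add
      (((hasDerivAt_id t).pow 2).const_mul (Real.eulerMascheroniConstant - 3 / 4))).congr_deriv ?_
    simp only [id, Pi.pow_apply, mainTerm]
    field_simp
    push_cast
    ring

theorem exists_abs_integral_Delta_sub_le : ∃ C : ℝ, 0 ≤ C ∧ ∀ x : ℝ, 1 ≤ x →
    |(∫ t in (1 : ℝ)..x, Delta t) - (x / 4 + G x)| ≤ C * Real.sqrt x := by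
  obtain ⟨C, hC⟩ := exists_abs_tsum_dualTerm_sub_G_le
  refine ⟨|C| + 3, by positivity, fun x hx => ?_⟩
  have h1 := abs_sum_d_mul_sub_le hx
  have h2 := hC x hx
  have hs : 1 ≤ Real.sqrt x := Real.one_le_sqrt.2 hx
  have h3 : ∫ t in (1 : ℝ)..x, Delta t = (∑ n ∈ Finset.Icc 1 ⌊x⌋₊, (d n : ℝ) * (x - n)) -
      (x ^ 2 / 2 * Real.log x + (Real.eulerMascheroniConstant - 3 / 4) * x ^ 2 -
        (Real.eulerMascheroniConstant - 3 / 4)) := by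
    rw [← integral_D hx, ← integral_mainTerm hx,
      ← intervalIntegral.integral_sub monotone_D.intervalIntegrable
        (continuous_mainTerm.intervalIntegrable _ _)]
    rfl
  have h4 : C * Real.sqrt x ≤ |C| * Real.sqrt x := by gcongr; exact le_abs_self C
  have h5 := Real.one_half_lt_eulerMascheroniConstant
  have h6 := Real.eulerMascheroniConstant_lt_two_thirds
  rw [h3]
  rw [abs_le] at h1 h2 ⊢
  constructor <;> nlinarith [h1.1, h1.2, h2.1, h2.2]

/-! ### The pointwise bound Δ(x) = O(√x). -/

theorem log_add_pos {t : ℝ} (ht : 1 ≤ t) : 0 < Real.log t + 2 * Real.eulerMascheroniConstant := by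
  have := Real.log_nonneg ht
  have := Real.one_half_lt_eulerMascheroniConstant
  linarith

theorem monotoneOn_mainTerm : MonotoneOn mainTerm (Ici 1) := by
  refine monotoneOn_of_deriv_nonneg (convex_Ici 1) continuous_mainTerm.continuousOn ?_ ?_
  · intro t ht
    rw [interior_Ici] at ht
    exact (hasDerivAt_mainTerm (one_pos.trans ht).ne').differentiableAt.differentiableWithinAt
  · intro t ht
    rw [interior_Ici] at ht
    rw [(hasDerivAt_mainTerm (one_pos.trans ht).ne').deriv]
    exact (log_add_pos (le_of_lt ht)).le

theorem mainTerm_sub_le {a b : ℝ} (ha : 1 ≤ a) (hab : a ≤ b) :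
    mainTerm b - mainTerm a ≤ (b - a) * (Real.log b + 2 * Real.eulerMascheroniConstant) := by
  have hpos : ∀ t ∈ Icc a b, t ≠ 0 := fun t ht => by linarith [ht.1]
  have h := (convex_Icc a b).image_sub_le_mul_sub_of_deriv_le
    (f := mainTerm) (C := Real.log b + 2 * Real.eulerMascheroniConstant)
    continuous_mainTerm.continuousOn (fun t ht => ?_) (fun t ht => ?_) a (left_mem_Icc.2 hab) b
    (right_mem_Icc.2 hab) hab
  · linarith
  · exact (hasDerivAt_mainTerm (hpos t (interior_subset ht))).differentiableAt.differentiableWithinAt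
  · have ht' := interior_subset ht
    rw [(hasDerivAt_mainTerm (hpos t ht')).deriv]
    have := Real.log_le_log (by linarith [ht'.1] : 0 < t) ht'.2
    linarith

theorem mul_Delta_sub_le_integral {a b : ℝ} (ha : 1 ≤ a) (hab : a ≤ b) :
    (b - a) * (Delta a - (mainTerm b - mainTerm a)) ≤ ∫ t in a..b, Delta t := by
  have h := intervalIntegral.integral_mono_on hab
    (intervalIntegrable_const (μ := volume) (c := Delta a - (mainTerm b - mainTerm a)))
    (intervalIntegrable_Delta a b) fun t ht => by
      have h1 : (D a : ℝ) ≤ D t := monotone_D ht.1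
      have h2 := monotoneOn_mainTerm (mem_Ici.2 (ha.trans ht.1)) (mem_Ici.2 (ha.trans hab)) ht.2
      simp only [Delta_eq]
      linarith
  rwa [intervalIntegral.integral_const, smul_eq_mul] at h

theorem integral_le_mul_Delta_add {a b : ℝ} (ha : 1 ≤ a) (hab : a ≤ b) :
    ∫ t in a..b, Delta t ≤ (b - a) * (Delta b + (mainTerm b - mainTerm a)) := by
  have h := intervalIntegral.integral_mono_on hab (intervalIntegrable_Delta a b)
    (intervalIntegrable_const (μ := volume) (c := Delta b + (mainTerm b - mainTerm a)))
    fun t ht => by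
      have h1 : (D t : ℝ) ≤ D b := monotone_D ht.2
      have h2 := monotoneOn_mainTerm (mem_Ici.2 ha) (mem_Ici.2 (ha.trans ht.1)) ht.1
      simp only [Delta_eq]
      linarith
  rwa [intervalIntegral.integral_const, smul_eq_mul] at h

theorem exists_abs_integral_Delta_sub_quarter_le : ∃ K : ℝ, 0 ≤ K ∧ ∀ x : ℝ, 1 ≤ x →
    |(∫ t in (1 : ℝ)..x, Delta t) - x / 4| ≤ K * x ^ (3 / 4 : ℝ) := by
  obtain ⟨C, hC0, hC⟩ := exists_abs_integral_Delta_sub_le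
  obtain ⟨B, hB0, hB⟩ := exists_abs_G_le
  refine ⟨C + B, by positivity, fun x hx => ?_⟩
  have h1 := hC x hx
  have h2 := hB x (by linarith)
  have h3 : C * Real.sqrt x ≤ C * x ^ (3 / 4 : ℝ) := by
    rw [Real.sqrt_eq_rpow]
    exact mul_le_mul_of_nonneg_left (Real.rpow_le_rpow_of_exponent_le hx (by norm_num)) hC0
  rw [add_mul]
  rw [abs_le] at h1 h2 ⊢
  constructor <;> linarith [h1.1, h1.2, h2.1, h2.2]

theorem log_le_four_mul {x : ℝ} (hx : 0 < x) : Real.log x ≤ 4 * x ^ (1 / 4 : ℝ) := by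
  have h := Real.log_le_sub_one_of_pos (Real.rpow_pos_of_pos hx (1 / 4 : ℝ))
  rw [Real.log_rpow hx] at h
  linarith

/-- A differencing argument: D is monotone, so over an interval of length η = x^(1/4) the value of Δ
at an endpoint is compared with its average at the cost of the growth of `mainTerm`, which is O(η
log x) = O(η²). The average itself is O(η³/η) by the estimate of ∫ Δ, and η² = √x. -/
theorem exists_abs_Delta_le : ∃ C : ℝ, 0 ≤ C ∧ ∀ x : ℝ, 1 ≤ x → |Delta x| ≤ C * Real.sqrt x := by
  obtain ⟨K, hK0, hK⟩ := exists_abs_integral_Delta_sub_quarter_le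
  refine ⟨8 * K + 8 + |mainTerm 2|, by positivity, fun x hx => ?_⟩
  have hx0 : 0 < x := by linarith
  set η := x ^ (1 / 4 : ℝ) with hη
  have hη0 : 0 < η := Real.rpow_pos_of_pos hx0 _
  have hη1 : 1 ≤ η := Real.one_le_rpow hx (by norm_num)
  have hs : Real.sqrt x = η ^ 2 := by
    rw [Real.sqrt_eq_rpow, hη, ← Real.rpow_natCast, ← Real.rpow_mul hx0.le]; norm_num
  have h34 : x ^ (3 / 4 : ℝ) = η ^ 3 := by
    rw [hη, ← Real.rpow_natCast, ← Real.rpow_mul hx0.le]; norm_num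
  have h4 : x = η ^ 4 := by
    rw [hη, ← Real.rpow_natCast, ← Real.rpow_mul hx0.le]; norm_num
  have hηx : η ≤ x := by rw [h4]; exact le_self_pow₀ hη1 (by norm_num)
  have hlog := log_le_four_mul hx0
  have hγ := Real.eulerMascheroniConstant_lt_two_thirds
  have hlog2 := Real.log_two_lt_d9
  have hRdiff : ∀ a b : ℝ, 1 ≤ a → a ≤ b → b ≤ 2 * x →
      |(∫ t in a..b, Delta t) - (b - a) / 4| ≤ 4 * K * η ^ 3 := by
    intro a b ha hab hb
    have e := intervalIntegral.integral_add_adjacent_intervals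
      (intervalIntegrable_Delta 1 a) (intervalIntegrable_Delta a b)
    have h1 := hK a ha
    have h2 := hK b (ha.trans hab)
    have h3 : ∀ y, 1 ≤ y → y ≤ 2 * x → K * y ^ (3 / 4 : ℝ) ≤ 2 * K * η ^ 3 := by
      intro y hy1 hy
      have : y ^ (3 / 4 : ℝ) ≤ 2 * η ^ 3 := by
        calc y ^ (3 / 4 : ℝ) ≤ (2 * x) ^ (3 / 4 : ℝ) := by gcongr
          _ = 2 ^ (3 / 4 : ℝ) * x ^ (3 / 4 : ℝ) := Real.mul_rpow (by norm_num) hx0.le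
          _ ≤ 2 ^ (1 : ℝ) * x ^ (3 / 4 : ℝ) := by gcongr <;> norm_num
          _ = _ := by rw [Real.rpow_one, h34]
      nlinarith
    have h5 := h3 a ha (hab.trans hb)
    have h6 := h3 b (ha.trans hab) hb
    rw [← e] at h2
    rw [abs_le] at h1 h2 ⊢
    constructor <;> linarith [h1.1, h1.2, h2.1, h2.2]
  have hup : Delta x ≤ (8 * K + 8) * η ^ 2 := by
    have h1 := mul_Delta_sub_le_integral hx (by linarith : x ≤ x + η)
    have h2 := mainTerm_sub_le hx (by linarith : x ≤ x + η)
    have h3 := (abs_le.1 (hRdiff x (x + η) hx (by linarith) (by linarith))).2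
    have hl : Real.log (x + η) ≤ Real.log 2 + Real.log x := by
      rw [← Real.log_mul two_ne_zero hx0.ne']
      exact Real.log_le_log (by linarith) (by linarith)
    rw [add_sub_cancel_left] at h1 h2 h3
    have h5 : η * (Delta x - (mainTerm (x + η) - mainTerm x)) ≤ η * (1 / 4 + 4 * K * η ^ 2) := by
      nlinarith
    have h6 := le_of_mul_le_mul_left h5 hη0
    nlinarith
  have hlow : -((8 * K + 8 + |mainTerm 2|) * η ^ 2) ≤ Delta x := by
    have hm := abs_nonneg (mainTerm 2)
    -- The backward interval [x - η/2, x] must stay inside [1, ∞), which x ≥ 2 and η ≤ x guarantee.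
    -- For x ≤ 2 the bound is immediate from D ≥ 0.
    rcases le_total x 2 with hx2 | hx2
    · have h1 := monotoneOn_mainTerm (mem_Ici.2 hx) (mem_Ici.2 (by norm_num : (1 : ℝ) ≤ 2)) hx2
      have h2 : (0 : ℝ) ≤ D x := Nat.cast_nonneg _
      have h3 := le_abs_self (mainTerm 2)
      rw [Delta_eq]
      nlinarith [sq_nonneg η]
    · have ha : 1 ≤ x - η / 2 := by nlinarith
      have h1 := integral_le_mul_Delta_add ha (by linarith : x - η / 2 ≤ x)
      have h2 := mainTerm_sub_le ha (by linarith : x - η / 2 ≤ x)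
      have h3 := (abs_le.1 (hRdiff (x - η / 2) x ha (by linarith) (by linarith))).1
      rw [sub_sub_cancel] at h1 h2 h3
      have h5 : η / 2 * (-(8 * K * η ^ 2)) ≤
          η / 2 * (Delta x + (mainTerm x - mainTerm (x - η / 2))) := by
        nlinarith
      have h6 := le_of_mul_le_mul_left h5 (by positivity)
      nlinarith [sq_nonneg η]
  rw [hs, abs_le]
  refine ⟨hlow, hup.trans ?_⟩
  have := abs_nonneg (mainTerm 2)
  nlinarith [sq_nonneg η]

/-! ### The exact identity for the sum of Δ(n)². -/

/-- Integration over `[1, x]` by primitives on the unit intervals between integers. -/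
theorem integral_eq_sum_unit_intervals {W : ℝ → ℝ} {P : ℕ → ℝ → ℝ} {x : ℝ} (hx : 1 ≤ x)
    (hW : IntervalIntegrable W volume 1 x)
    (hc : ∀ n : ℕ, 1 ≤ n → ContinuousOn (P n) (Icc n (n + 1)))
    (hd : ∀ n : ℕ, 1 ≤ n → ∀ t ∈ Ioo (n : ℝ) (n + 1), HasDerivAt (P n) (W t) t) :
    ∫ t in (1 : ℝ)..x, W t = (∑ n ∈ Finset.Ico 1 ⌊x⌋₊, (P n (n + 1) - P n n)) +
      (P ⌊x⌋₊ x - P ⌊x⌋₊ ⌊x⌋₊) := by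
  have hN : 1 ≤ ⌊x⌋₊ := (Nat.one_le_floor_iff x).2 hx
  have hN' : (1 : ℝ) ≤ ⌊x⌋₊ := by exact_mod_cast hN
  have hNx : (⌊x⌋₊ : ℝ) ≤ x := Nat.floor_le (by linarith)
  have hint : ∀ a b : ℝ, 1 ≤ a → a ≤ b → b ≤ x → IntervalIntegrable W volume a b :=
    fun a b h1 h2 h3 => hW.mono_set (by
      rw [uIcc_of_le h2, uIcc_of_le hx]; exact Icc_subset_Icc h1 h3)
  have hFTC : ∀ n : ℕ, 1 ≤ n → ∀ y : ℝ, n ≤ y → y ≤ n + 1 → y ≤ x →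
      ∫ t in (n : ℝ)..y, W t = P n y - P n n := by
    intro n hn y h1 h2 h3
    refine intervalIntegral.integral_eq_sub_of_hasDerivAt_of_le h1
      ((hc n hn).mono (Icc_subset_Icc_right h2))
      (fun t ht => hd n hn t ⟨ht.1, ht.2.trans_le h2⟩) (hint n y (by exact_mod_cast hn) h1 h3)
  have hsucc : ∀ n ∈ Finset.Ico 1 ⌊x⌋₊, 1 ≤ n ∧ (n : ℝ) + 1 ≤ x := by
    intro n hn
    rw [Finset.mem_Ico] at hn
    refine ⟨hn.1, le_trans ?_ hNx⟩
    exact_mod_cast hn.2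
  rw [← intervalIntegral.integral_add_adjacent_intervals (hint 1 ⌊x⌋₊ le_rfl hN' hNx)
    (hint ⌊x⌋₊ x hN' hNx le_rfl), hFTC ⌊x⌋₊ hN x hNx (Nat.lt_floor_add_one x).le le_rfl]
  congr 1
  have h := intervalIntegral.sum_integral_adjacent_intervals_Ico (a := fun k : ℕ => (k : ℝ))
    (f := W) (μ := volume) hN fun k hk => by
      rw [← Finset.coe_Ico] at hk
      have := hsucc k hk
      refine hint _ _ (by exact_mod_cast this.1) (by push_cast; linarith) (by push_cast; exact this.2)
  rw [Nat.cast_one] at h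
  rw [← h]
  refine Finset.sum_congr rfl fun n hn => ?_
  have := hsucc n hn
  push_cast
  exact hFTC n this.1 _ (by linarith) le_rfl this.2

theorem floor_eq_of_mem_Ioo {n : ℕ} {t : ℝ} (ht : t ∈ Ioo (n : ℝ) (n + 1)) :
    ⌊t⌋₊ = n ∧ ⌊t⌋ = n := by
  refine ⟨(Nat.floor_eq_iff ((Nat.cast_nonneg n).trans ht.1.le)).2 ⟨ht.1.le, ht.2⟩, ?_⟩
  rw [Int.floor_eq_iff]
  exact ⟨by exact_mod_cast ht.1.le, by exact_mod_cast ht.2⟩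

theorem D_eq_of_mem_Ioo {n : ℕ} {t : ℝ} (ht : t ∈ Ioo (n : ℝ) (n + 1)) : D t = D n := by
  rw [D, D, (floor_eq_of_mem_Ioo ht).1, Nat.floor_natCast]

theorem psi_eq_of_mem_Ioo {n : ℕ} {t : ℝ} (ht : t ∈ Ioo (n : ℝ) (n + 1)) : psi t = t - n - 1 / 2 := by
  rw [psi, (floor_eq_of_mem_Ioo ht).2]
  push_cast
  ring

theorem measurable_Delta : Measurable Delta :=
  monotone_D.measurable.sub continuous_mainTerm.measurable

theorem measurable_psi : Measurable psi :=
  (measurable_id.sub (measurable_from_top.comp Int.measurable_floor)).sub_const _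

theorem abs_psi_le (t : ℝ) : |psi t| ≤ 1 := by
  have h1 := Int.floor_le t
  have h2 := Int.lt_floor_add_one t
  rw [psi, abs_le]
  constructor <;> linarith

theorem intervalIntegrable_of_measurable_of_bounded {W : ℝ → ℝ} (hm : Measurable W) {a b B : ℝ}
    (hab : a ≤ b) (hB : ∀ t ∈ Icc a b, |W t| ≤ B) : IntervalIntegrable W volume a b := by
  rw [intervalIntegrable_iff_integrableOn_Ioc_of_le hab]
  refine Measure.integrableOn_of_bounded (M := B) (by simp) hm.aestronglyMeasurable ?_
  filter_upwards [ae_restrict_mem measurableSet_Ioc] with t ht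
  exact hB t ⟨ht.1.le, ht.2⟩

theorem exists_bound_Delta {x : ℝ} (hx : 1 ≤ x) :
    ∃ B : ℝ, 0 ≤ B ∧ ∀ t ∈ Icc 1 x, |Delta t| ≤ B := by
  obtain ⟨C, hC0, hC⟩ := exists_abs_Delta_le
  refine ⟨C * Real.sqrt x, by positivity, fun t ht => (hC t ht.1).trans ?_⟩
  gcongr
  exact ht.2

theorem intervalIntegrable_Delta_sq {x : ℝ} (hx : 1 ≤ x) :
    IntervalIntegrable (fun t => Delta t ^ 2) volume 1 x := by
  obtain ⟨B, hB0, hB⟩ := exists_bound_Delta hx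
  refine intervalIntegrable_of_measurable_of_bounded (measurable_Delta.pow_const 2) hx (B := B ^ 2)
    fun t ht => ?_
  rw [abs_pow]
  exact pow_le_pow_left₀ (abs_nonneg _) (hB t ht) 2

/-- The derivative `log t + 2γ` of the main term. -/
noncomputable def mainDeriv (t : ℝ) : ℝ := Real.log t + 2 * Real.eulerMascheroniConstant

theorem hasDerivAt_mainDeriv {t : ℝ} (ht : t ≠ 0) : HasDerivAt mainDeriv t⁻¹ t :=
  (Real.hasDerivAt_log ht).add_const _

theorem continuousOn_mainDeriv {a b : ℝ} (ha : 1 ≤ a) : ContinuousOn mainDeriv (Icc a b) :=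
  fun _ ht => (hasDerivAt_mainDeriv (by linarith [ht.1])).continuousAt.continuousWithinAt

theorem continuousOn_inv_Icc {a b : ℝ} (ha : 1 ≤ a) : ContinuousOn (fun t : ℝ => t⁻¹) (Icc a b) :=
  continuousOn_id.inv₀ fun t ht => by
    have : 0 < t := by linarith [ht.1]
    exact this.ne'

theorem intervalIntegrable_psi_mul_Delta {x : ℝ} (hx : 1 ≤ x) :
    IntervalIntegrable (fun t => psi t * Delta t) volume 1 x := by
  obtain ⟨B, hB0, hB⟩ := exists_bound_Delta hx
  refine intervalIntegrable_of_measurable_of_bounded (measurable_psi.mul measurable_Delta) hx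
    (B := 1 * B) fun t ht => ?_
  rw [Pi.mul_apply, abs_mul]
  exact mul_le_mul (abs_psi_le t) (hB t ht) (abs_nonneg _) zero_le_one

theorem abs_fractQuad_le (t : ℝ) : |fractQuad t| ≤ 1 / 8 := by
  rw [abs_of_nonneg (fractQuad_nonneg t)]
  exact fractQuad_le t

theorem intervalIntegrable_fractQuad_mul_Delta {x : ℝ} (hx : 1 ≤ x) :
    IntervalIntegrable (fun t => fractQuad t * Delta t) volume 1 x := by
  obtain ⟨B, hB0, hB⟩ := exists_bound_Delta hx
  refine intervalIntegrable_of_measurable_of_bounded (measurable_fractQuad.mul measurable_Delta) hx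
    (B := 1 / 8 * B) fun t ht => ?_
  rw [Pi.mul_apply, abs_mul]
  exact mul_le_mul (abs_fractQuad_le t) (hB t ht) (abs_nonneg _) (by norm_num)

theorem intervalIntegrable_fractQuad {x : ℝ} (hx : 1 ≤ x) :
    IntervalIntegrable fractQuad volume 1 x :=
  intervalIntegrable_of_measurable_of_bounded measurable_fractQuad hx fun t _ => abs_fractQuad_le t

theorem D_floor (x : ℝ) : D (⌊x⌋₊ : ℝ) = D x := by
  rw [D, D, Nat.floor_natCast]

theorem psi_eq_sub_floor {x : ℝ} (hx : 0 ≤ x) : psi x = x - ⌊x⌋₊ - 1 / 2 := by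
  rw [psi, natCast_floor_eq_intCast_floor hx]

theorem hasDerivAt_sub_mainTerm (c : ℝ) {t : ℝ} (ht : t ≠ 0) :
    HasDerivAt (fun t => c - mainTerm t) (-mainDeriv t) t :=
  (hasDerivAt_mainTerm ht).const_sub c

theorem sum_Delta_sq_eq {x : ℝ} (hx : 1 ≤ x) :
    ∑ n ∈ Finset.Icc 1 ⌊x⌋₊, Delta (n : ℝ) ^ 2 = (1 / 2 - psi x) * Delta x ^ 2 +
      (∫ t in (1 : ℝ)..x, Delta t ^ 2) + (∫ t in (1 : ℝ)..x, Delta t * mainDeriv t) -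
      2 * ∫ t in (1 : ℝ)..x, psi t * Delta t * mainDeriv t := by
  have hu : uIcc 1 x = Icc 1 x := uIcc_of_le hx
  have i1 := intervalIntegrable_Delta_sq hx
  have i2 : IntervalIntegrable (fun t => Delta t * mainDeriv t) volume 1 x :=
    (intervalIntegrable_Delta 1 x).mul_continuousOn (by rw [hu]; exact continuousOn_mainDeriv le_rfl)
  have i3 : IntervalIntegrable (fun t => psi t * Delta t * mainDeriv t) volume 1 x :=
    (intervalIntegrable_psi_mul_Delta hx).mul_continuousOn
      (by rw [hu]; exact continuousOn_mainDeriv le_rfl)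
  have h := integral_eq_sum_unit_intervals hx ((i1.add i2).sub (i3.const_mul 2))
    -- The factor t - n - 1 equals ψ(t) - 1/2 inside the interval. It is 0 at the right end and -1
    -- at the left end, so every complete interval contributes exactly Δ(n)².
    (P := fun n t => (t - n - 1) * ((D (n : ℝ) : ℝ) - mainTerm t) ^ 2) (fun n _ => ?_) (fun n hn t ht => ?_)
  · rw [intervalIntegral.integral_sub (i1.add i2) (i3.const_mul 2), intervalIntegral.integral_add i1 i2,
      intervalIntegral.integral_const_mul] at h
    have hN : 1 ≤ ⌊x⌋₊ := (Nat.one_le_floor_iff x).2 hx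
    rw [← Finset.Ico_insert_right hN, Finset.sum_insert Finset.right_notMem_Ico]
    have e1 : ∀ n : ℕ, ((n : ℝ) + 1 - n - 1) * ((D (n : ℝ) : ℝ) - mainTerm ((n : ℝ) + 1)) ^ 2 -
        ((n : ℝ) - n - 1) * ((D (n : ℝ) : ℝ) - mainTerm n) ^ 2 = Delta n ^ 2 := by
      intro n
      rw [Delta_eq]
      ring
    simp only [e1] at h
    rw [D_floor] at h
    rw [psi_eq_sub_floor (by linarith), Delta_eq (⌊x⌋₊ : ℝ), D_floor, Delta_eq x]
    linarith
  · have := continuous_mainTerm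
    fun_prop
  · have hn1 : (1 : ℝ) ≤ n := by exact_mod_cast hn
    have ht0 : t ≠ 0 := by linarith [ht.1]
    refine (((((hasDerivAt_id t).sub_const (n : ℝ)).sub_const 1)).mul
      ((hasDerivAt_sub_mainTerm (D (n : ℝ)) ht0).pow 2)).congr_deriv ?_
    rw [Delta_eq, D_eq_of_mem_Ioo ht, psi_eq_of_mem_Ioo ht]
    simp only [id, Pi.pow_apply]
    push_cast
    ring

/-! ### Integration by parts of the sawtooth integral. -/

theorem fractQuad_eq_of_mem_Ioo {n : ℕ} {t : ℝ} (ht : t ∈ Ioo (n : ℝ) (n + 1)) :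
    fractQuad t = ((t - n) - (t - n) ^ 2) / 2 := fractQuad_eq n ht.1.le ht.2.le

/-- -`fractQuad` is a primitive of ψ vanishing at every integer, so the jumps of Δ leave no boundary
terms. Between integers Δ has derivative -`mainDeriv`, which is the source of the squared term. -/
theorem integral_psi_mul_Delta_mul_mainDeriv {x : ℝ} (hx : 1 ≤ x) :
    ∫ t in (1 : ℝ)..x, psi t * Delta t * mainDeriv t =
      -(fractQuad x * Delta x * mainDeriv x) + (∫ t in (1 : ℝ)..x, fractQuad t * Delta t * t⁻¹) -
        ∫ t in (1 : ℝ)..x, fractQuad t * mainDeriv t ^ 2 := by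
  have hu : uIcc 1 x = Icc 1 x := uIcc_of_le hx
  have i1 : IntervalIntegrable (fun t => psi t * Delta t * mainDeriv t) volume 1 x :=
    (intervalIntegrable_psi_mul_Delta hx).mul_continuousOn
      (by rw [hu]; exact continuousOn_mainDeriv le_rfl)
  have i2 : IntervalIntegrable (fun t => fractQuad t * Delta t * t⁻¹) volume 1 x :=
    (intervalIntegrable_fractQuad_mul_Delta hx).mul_continuousOn
      (by rw [hu]; exact continuousOn_inv_Icc le_rfl)
  have i3 : IntervalIntegrable (fun t => fractQuad t * mainDeriv t ^ 2) volume 1 x :=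
    (intervalIntegrable_fractQuad hx).mul_continuousOn
      (by rw [hu]; exact (continuousOn_mainDeriv le_rfl).pow 2)
  have h := integral_eq_sum_unit_intervals hx ((i1.sub i2).add i3)
    (P := fun n t => -(((t - n) - (t - n) ^ 2) / 2) * ((D (n : ℝ) : ℝ) - mainTerm t) * mainDeriv t)
    (fun n hn => ?_) (fun n hn t ht => ?_)
  · rw [intervalIntegral.integral_add (i1.sub i2) i3, intervalIntegral.integral_sub i1 i2] at h
    have e1 : ∀ n : ℕ, -(((n : ℝ) + 1 - n - ((n : ℝ) + 1 - n) ^ 2) / 2) *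
        ((D (n : ℝ) : ℝ) - mainTerm ((n : ℝ) + 1)) * mainDeriv ((n : ℝ) + 1) -
        -(((n : ℝ) - n - ((n : ℝ) - n) ^ 2) / 2) * ((D (n : ℝ) : ℝ) - mainTerm n) * mainDeriv n = 0 := by
      intro n
      ring
    simp only [e1, Finset.sum_const_zero, zero_add] at h
    rw [D_floor] at h
    have e2 := fractQuad_eq ⌊x⌋₊ (Nat.floor_le (by linarith)) (Nat.lt_floor_add_one x).le
    rw [e2, Delta_eq]
    linarith
  · have h1 := continuous_mainTerm
    have h2 : ContinuousOn mainDeriv (Icc (n : ℝ) (n + 1)) :=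
      continuousOn_mainDeriv (by exact_mod_cast hn)
    exact ContinuousOn.mul (by fun_prop) h2
  · have hn1 : (1 : ℝ) ≤ n := by exact_mod_cast hn
    have ht0 : t ≠ 0 := by linarith [ht.1]
    have hθ := (hasDerivAt_id t).sub_const (n : ℝ)
    refine ((((hθ.sub (hθ.pow 2)).div_const 2).neg.mul
      (hasDerivAt_sub_mainTerm (D (n : ℝ)) ht0)).mul (hasDerivAt_mainDeriv ht0)).congr_deriv ?_
    rw [Delta_eq, D_eq_of_mem_Ioo ht, psi_eq_of_mem_Ioo ht, fractQuad_eq_of_mem_Ioo ht]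
    simp only [id, Pi.mul_apply, Pi.neg_apply, Pi.sub_apply, Pi.pow_apply]
    push_cast
    ring

/-- The continuous periodic primitive of `fractQuad - 1 / 12` vanishing at the integers. -/
noncomputable def fractCubic (y : ℝ) : ℝ :=
  Int.fract y ^ 2 / 4 - Int.fract y ^ 3 / 6 - Int.fract y / 12

theorem abs_fractCubic_le (y : ℝ) : |fractCubic y| ≤ 1 := by
  have h1 := Int.fract_nonneg y
  have h2 := (Int.fract_lt_one y).le
  have h3 : Int.fract y ^ 2 ≤ 1 := pow_le_one₀ h1 h2
  have h4 : Int.fract y ^ 3 ≤ 1 := pow_le_one₀ h1 h2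
  have h5 : 0 ≤ Int.fract y ^ 2 := by positivity
  have h6 : 0 ≤ Int.fract y ^ 3 := by positivity
  rw [fractCubic, abs_le]
  constructor <;> linarith

theorem measurable_fractCubic : Measurable fractCubic := by
  unfold fractCubic
  exact (((measurable_fract.pow_const 2).div_const 4).sub
    ((measurable_fract.pow_const 3).div_const 6)).sub (measurable_fract.div_const 12)

theorem fractCubic_eq {n : ℕ} {t : ℝ} (h1 : (n : ℝ) ≤ t) (h2 : t < n + 1) :
    fractCubic t = (t - n) ^ 2 / 4 - (t - n) ^ 3 / 6 - (t - n) / 12 := by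
  have : Int.fract t = t - n := by
    rw [Int.fract_eq_iff]
    exact ⟨by linarith, by linarith, n, by push_cast; ring⟩
  rw [fractCubic, this]

/-- `fractQuad` is replaced by its mean 1/12 over a period. A second integration by parts with
`fractCubic` shows that the oscillating remainder contributes only O(log² x). -/
theorem integral_fractQuad_mul_mainDeriv_sq {x : ℝ} (hx : 1 ≤ x) :
    ∫ t in (1 : ℝ)..x, fractQuad t * mainDeriv t ^ 2 =
      1 / 12 * (∫ t in (1 : ℝ)..x, mainDeriv t ^ 2) + fractCubic x * mainDeriv x ^ 2 -
        2 * ∫ t in (1 : ℝ)..x, fractCubic t * (mainDeriv t * t⁻¹) := by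
  have hu : uIcc 1 x = Icc 1 x := uIcc_of_le hx
  have hm : ContinuousOn mainDeriv (uIcc 1 x) := by rw [hu]; exact continuousOn_mainDeriv le_rfl
  have i1 : IntervalIntegrable (fun t => fractQuad t * mainDeriv t ^ 2) volume 1 x :=
    (intervalIntegrable_fractQuad hx).mul_continuousOn (hm.pow 2)
  have i2 : IntervalIntegrable (fun t => mainDeriv t ^ 2) volume 1 x :=
    (hm.pow 2).intervalIntegrable
  have i3 : IntervalIntegrable (fun t => fractCubic t * (mainDeriv t * t⁻¹)) volume 1 x :=
    (intervalIntegrable_of_measurable_of_bounded measurable_fractCubic hx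
      fun t _ => abs_fractCubic_le t).mul_continuousOn
      (hm.mul (by rw [hu]; exact continuousOn_inv_Icc le_rfl))
  have h := integral_eq_sum_unit_intervals hx ((i1.sub (i2.const_mul (1 / 12))).add (i3.const_mul 2))
    (P := fun n t => ((t - n) ^ 2 / 4 - (t - n) ^ 3 / 6 - (t - n) / 12) * mainDeriv t ^ 2)
    (fun n hn => ?_) (fun n hn t ht => ?_)
  · rw [intervalIntegral.integral_add (i1.sub (i2.const_mul _)) (i3.const_mul 2),
      intervalIntegral.integral_sub i1 (i2.const_mul _), intervalIntegral.integral_const_mul,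
      intervalIntegral.integral_const_mul] at h
    have e1 : ∀ n : ℕ, (((n : ℝ) + 1 - n) ^ 2 / 4 - ((n : ℝ) + 1 - n) ^ 3 / 6 -
        ((n : ℝ) + 1 - n) / 12) * mainDeriv ((n : ℝ) + 1) ^ 2 -
        (((n : ℝ) - n) ^ 2 / 4 - ((n : ℝ) - n) ^ 3 / 6 - ((n : ℝ) - n) / 12) * mainDeriv n ^ 2 = 0 := by
      intro n
      ring
    simp only [e1, Finset.sum_const_zero, zero_add] at h
    rw [fractCubic_eq (Nat.floor_le (by linarith)) (Nat.lt_floor_add_one x)]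
    linarith
  · have h2 : ContinuousOn mainDeriv (Icc (n : ℝ) (n + 1)) :=
      continuousOn_mainDeriv (by exact_mod_cast hn)
    exact ContinuousOn.mul (by fun_prop) (h2.pow 2)
  · have hn1 : (1 : ℝ) ≤ n := by exact_mod_cast hn
    have ht0 : t ≠ 0 := by linarith [ht.1]
    have hθ := (hasDerivAt_id t).sub_const (n : ℝ)
    refine (((((hθ.pow 2).div_const 4).sub ((hθ.pow 3).div_const 6)).sub (hθ.div_const 12)).mul
      ((hasDerivAt_mainDeriv ht0).pow 2)).congr_deriv ?_
    rw [fractQuad_eq_of_mem_Ioo ht, fractCubic_eq ht.1.le ht.2]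
    simp only [id, Pi.sub_apply, Pi.pow_apply]
    push_cast
    ring

theorem integral_mainDeriv_sq {x : ℝ} (hx : 1 ≤ x) :
    ∫ t in (1 : ℝ)..x, mainDeriv t ^ 2 =
      x * Real.log x ^ 2 + (4 * Real.eulerMascheroniConstant - 2) * (x * Real.log x) +
        (2 - 4 * Real.eulerMascheroniConstant + 4 * Real.eulerMascheroniConstant ^ 2) * (x - 1) := by
  have hu : uIcc 1 x = Icc 1 x := uIcc_of_le hx
  rw [intervalIntegral.integral_eq_sub_of_hasDerivAt (f := fun t => t * Real.log t ^ 2 +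
    (4 * Real.eulerMascheroniConstant - 2) * (t * Real.log t) +
    (2 - 4 * Real.eulerMascheroniConstant + 4 * Real.eulerMascheroniConstant ^ 2) * t)]
  · simp only [Real.log_one]
    ring
  · intro t ht
    rw [hu] at ht
    have ht0 : t ≠ 0 := by linarith [ht.1]
    have hl := Real.hasDerivAt_log ht0
    refine ((((hasDerivAt_id t).mul (hl.pow 2)).add
      (((hasDerivAt_id t).mul hl).const_mul (4 * Real.eulerMascheroniConstant - 2))).add
      ((hasDerivAt_id t).const_mul (2 - 4 * Real.eulerMascheroniConstant +
        4 * Real.eulerMascheroniConstant ^ 2))).congr_deriv ?_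
    simp only [id, mainDeriv, Pi.pow_apply]
    field_simp
    push_cast
    ring
  · refine ContinuousOn.intervalIntegrable ?_
    rw [hu]
    exact (continuousOn_mainDeriv le_rfl).pow 2

/-! ### The integral of Δ(t)(log t + 2γ). -/

theorem continuous_integral_Delta : Continuous fun x : ℝ => ∫ t in (1 : ℝ)..x, Delta t :=
  intervalIntegral.continuous_primitive intervalIntegrable_Delta 1

theorem hasDerivAt_integral_Delta {n : ℕ} {x : ℝ} (hx : x ∈ Ioo (n : ℝ) (n + 1)) :
    HasDerivAt (fun x : ℝ => ∫ t in (1 : ℝ)..x, Delta t) (Delta x) x := by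
  have hev : Delta =ᶠ[𝓝 x] fun t => (D (n : ℝ) : ℝ) - mainTerm t := by
    filter_upwards [isOpen_Ioo.mem_nhds hx] with t ht
    rw [Delta_eq, D_eq_of_mem_Ioo ht]
  have hc : ContinuousAt Delta x :=
    (continuous_const.sub continuous_mainTerm).continuousAt.congr hev.symm
  exact intervalIntegral.integral_hasDerivAt_right (intervalIntegrable_Delta 1 x)
    (measurable_Delta.stronglyMeasurable.stronglyMeasurableAtFilter) hc

/-- The primitive of Δ is continuous across integers and vanishes at 1, so the boundary terms
telescope and only the one at x remains. -/
theorem integral_Delta_mul_mainDeriv {x : ℝ} (hx : 1 ≤ x) :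
    ∫ t in (1 : ℝ)..x, Delta t * mainDeriv t = mainDeriv x * (∫ t in (1 : ℝ)..x, Delta t) -
      ∫ t in (1 : ℝ)..x, (∫ s in (1 : ℝ)..t, Delta s) * t⁻¹ := by
  have hu : uIcc 1 x = Icc 1 x := uIcc_of_le hx
  have i1 : IntervalIntegrable (fun t => Delta t * mainDeriv t) volume 1 x :=
    (intervalIntegrable_Delta 1 x).mul_continuousOn (by rw [hu]; exact continuousOn_mainDeriv le_rfl)
  have i2 : IntervalIntegrable (fun t => (∫ s in (1 : ℝ)..t, Delta s) * t⁻¹) volume 1 x := by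
    refine ContinuousOn.intervalIntegrable ?_
    rw [hu]
    exact continuous_integral_Delta.continuousOn.mul (continuousOn_inv_Icc le_rfl)
  have h := integral_eq_sum_unit_intervals hx (i1.add i2)
    (P := fun _ t => mainDeriv t * ∫ s in (1 : ℝ)..t, Delta s) (fun n hn => ?_) (fun n hn t ht => ?_)
  · rw [intervalIntegral.integral_add i1 i2] at h
    have hN : 1 ≤ ⌊x⌋₊ := (Nat.one_le_floor_iff x).2 hx
    have h2 := Finset.sum_Ico_sub (fun n : ℕ => mainDeriv n * ∫ s in (1 : ℝ)..n, Delta s) hN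
    push_cast at h2
    rw [h2, intervalIntegral.integral_same] at h
    linarith
  · exact (continuousOn_mainDeriv (by exact_mod_cast hn)).mul continuous_integral_Delta.continuousOn
  · have hn1 : (1 : ℝ) ≤ n := by exact_mod_cast hn
    have ht0 : t ≠ 0 := by linarith [ht.1]
    refine ((hasDerivAt_mainDeriv ht0).mul (hasDerivAt_integral_Delta ht)).congr_deriv ?_
    ring

theorem continuous_GTerm (n : ℕ) : Continuous fun x => GTerm x n := by
  unfold GTerm
  fun_prop

theorem continuous_G : Continuous G := by
  have h : Continuous fun x => ∑' n : ℕ, GTerm x n :=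
    continuous_tsum continuous_GTerm
      (summable_d_mul_rpow_inv (by norm_num : (1 : ℝ) < 5 / 4)) fun n x => abs_GTerm_le x n
  unfold G
  exact (continuous_const.mul (Real.continuous_rpow_const (by norm_num))).mul h

/-- The phase derivative is 2π√n/√t, so the first derivative test leaves the weight t^(1/4)/(2π√n).
This is increasing and serves as its own majorant of variation; the resulting O(x^(1/4)) is more
than is required. -/
theorem abs_integral_rpow_mul_sin_le {n : ℕ} (hn : 1 ≤ n) {x : ℝ} (hx : 1 ≤ x) :
    |∫ t in (1 : ℝ)..x, t ^ (-1 / 4 : ℝ) *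
      Real.sin (4 * Real.pi * Real.sqrt ((n : ℝ) * t) - Real.pi / 4)| ≤ Real.sqrt x := by
  have hpi := Real.pi_gt_three
  have hn' : (1 : ℝ) ≤ n := by exact_mod_cast hn
  have hsn : 1 ≤ Real.sqrt n := Real.one_le_sqrt.2 hn'
  have hpos : ∀ t ∈ Icc 1 x, 0 < t := fun t ht => by linarith [ht.1]
  have hqd : ∀ t ∈ Icc 1 x, HasDerivAt (fun t => t ^ (1 / 4 : ℝ) / (2 * Real.pi * Real.sqrt n))
      (1 / 4 * t ^ (1 / 4 - 1 : ℝ) / (2 * Real.pi * Real.sqrt n)) t := fun t ht =>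
    (Real.hasDerivAt_rpow_const (Or.inl (hpos t ht).ne')).div_const _
  have hqc : ContinuousOn (fun t : ℝ => 1 / 4 * t ^ (1 / 4 - 1 : ℝ) / (2 * Real.pi * Real.sqrt n))
      (Icc 1 x) :=
    (continuousOn_const.mul (continuousOn_id.rpow_const fun t ht => Or.inl (hpos t ht).ne')).div_const _
  have key := norm_integral_smul_deriv_le (E := ℝ) (a := 1) (b := x) (K := 1)
    (F := fun t => -Real.cos (4 * Real.pi * Real.sqrt n * Real.sqrt t - Real.pi / 4))
    (F' := fun t => Real.sin (4 * Real.pi * Real.sqrt n * Real.sqrt t - Real.pi / 4) *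
      (2 * Real.pi * Real.sqrt n / Real.sqrt t))
    (q := fun t => t ^ (1 / 4 : ℝ) / (2 * Real.pi * Real.sqrt n))
    (r := fun t => t ^ (1 / 4 : ℝ) / (2 * Real.pi * Real.sqrt n))
    hx ?_ ?_ ?_ hqd hqc hqd hqc ?_
  · have e1 : ∫ t in (1 : ℝ)..x, (t ^ (1 / 4 : ℝ) / (2 * Real.pi * Real.sqrt n)) •
        (Real.sin (4 * Real.pi * Real.sqrt n * Real.sqrt t - Real.pi / 4) *
          (2 * Real.pi * Real.sqrt n / Real.sqrt t)) =
        ∫ t in (1 : ℝ)..x, t ^ (-1 / 4 : ℝ) *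
          Real.sin (4 * Real.pi * Real.sqrt ((n : ℝ) * t) - Real.pi / 4) := by
      refine intervalIntegral.integral_congr fun t ht => ?_
      rw [uIcc_of_le hx] at ht
      have ht0 := hpos t ht
      have hst := Real.sqrt_pos.2 ht0
      have e2 : t ^ (-1 / 4 : ℝ) = t ^ (1 / 4 : ℝ) / Real.sqrt t := by
        rw [Real.sqrt_eq_rpow, ← Real.rpow_sub ht0]; norm_num
      simp only [smul_eq_mul]
      rw [Real.sqrt_mul (by linarith), e2, ← mul_assoc (4 * Real.pi)]
      field_simp
    rw [e1] at key
    refine key.trans ?_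
    have h1 : 0 ≤ x ^ (1 / 4 : ℝ) := by positivity
    have h2 : x ^ (1 / 4 : ℝ) ≤ Real.sqrt x := by
      rw [Real.sqrt_eq_rpow]
      exact Real.rpow_le_rpow_of_exponent_le hx (by norm_num)
    have h3 : x ^ (1 / 4 : ℝ) / (2 * Real.pi * Real.sqrt n) ≤ x ^ (1 / 4 : ℝ) / 2 := by
      gcongr
      nlinarith
    rw [abs_of_nonneg (by positivity), abs_of_nonneg (by positivity)]
    linarith
  · intro t ht
    have ht0 := hpos t ht
    refine ((((Real.hasDerivAt_sqrt ht0.ne').const_mul (4 * Real.pi * Real.sqrt n)).sub_const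
      (Real.pi / 4)).cos.neg).congr_deriv ?_
    have hst := Real.sqrt_pos.2 ht0
    field_simp
    ring
  · refine ContinuousOn.mul (by fun_prop) (continuousOn_const.div (by fun_prop) fun t ht => ?_)
    exact (Real.sqrt_pos.2 (hpos t ht)).ne'
  · intro t _
    rw [norm_neg]
    exact Real.abs_cos_le_one _
  · intro t ht
    have := hpos t ht
    rw [abs_of_nonneg (by positivity)]

/-- The trivial bound G(t) = O(t^(3/4)) would give only O(x^(3/4)). Absolute convergence of the
series allows termwise integration, and each oscillating term is then bounded with constants
summable in n. -/
theorem exists_abs_integral_G_mul_inv_le : ∃ C : ℝ, 0 ≤ C ∧ ∀ x : ℝ, 1 ≤ x →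
    |∫ t in (1 : ℝ)..x, G t * t⁻¹| ≤ C * Real.sqrt x := by
  have hs := summable_d_mul_rpow_inv (by norm_num : (1 : ℝ) < 5 / 4)
  set c : ℝ := 1 / (2 * Real.sqrt 2 * Real.pi ^ 2) with hc
  have hc0 : 0 ≤ c := by positivity
  refine ⟨c * ∑' n : ℕ, (d n : ℝ) * ((n : ℝ) ^ (5 / 4 : ℝ))⁻¹,
    mul_nonneg hc0 (tsum_nonneg fun n => by positivity), fun x hx => ?_⟩
  have hpos : ∀ t ∈ uIoc 1 x, 1 ≤ t := fun t ht => by rw [uIoc_of_le hx] at ht; exact ht.1.le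
  have hsum : HasSum (fun n : ℕ => ∫ t in (1 : ℝ)..x, c * (t ^ (-1 / 4 : ℝ) * GTerm t n))
      (∫ t in (1 : ℝ)..x, G t * t⁻¹) := by
    refine intervalIntegral.hasSum_integral_of_dominated_convergence
      (fun n _ => c * ((d n : ℝ) * ((n : ℝ) ^ (5 / 4 : ℝ))⁻¹)) (fun n => ?_) (fun n => ?_) ?_ ?_ ?_
    · exact ((measurable_id.pow_const _).mul
        (continuous_GTerm n).measurable).const_mul c |>.aestronglyMeasurable
    · refine Eventually.of_forall fun t ht => ?_
      have ht1 := hpos t ht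
      rw [norm_mul, norm_mul, Real.norm_eq_abs, Real.norm_eq_abs, Real.norm_eq_abs, abs_of_nonneg hc0,
        abs_of_nonneg (by positivity)]
      refine mul_le_mul_of_nonneg_left ?_ hc0
      calc _ ≤ 1 * ((d n : ℝ) * ((n : ℝ) ^ (5 / 4 : ℝ))⁻¹) :=
            mul_le_mul (Real.rpow_le_one_of_one_le_of_nonpos ht1 (by norm_num)) (abs_GTerm_le t n)
              (abs_nonneg _) zero_le_one
        _ = _ := one_mul _
    · exact Eventually.of_forall fun t _ => hs.mul_left c
    · exact intervalIntegrable_const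
    · refine Eventually.of_forall fun t ht => ?_
      have ht0 : 0 < t := by linarith [hpos t ht]
      have h := ((summable_GTerm t).hasSum.mul_left (t ^ (-1 / 4 : ℝ))).mul_left c
      convert! h using 1
      have e : t ^ (-1 / 4 : ℝ) = t ^ (3 / 4 : ℝ) * t⁻¹ := by
        rw [← Real.rpow_neg_one, ← Real.rpow_add ht0]; norm_num
      rw [e, G, ← hc]
      ring
  rw [← hsum.tsum_eq, ← Real.norm_eq_abs]
  refine tsum_of_norm_bounded ((hs.hasSum.mul_left c).mul_right _) fun n => ?_
  rcases Nat.eq_zero_or_pos n with rfl | hn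
  · simp [d, GTerm]
  · have e : ∀ t : ℝ, c * (t ^ (-1 / 4 : ℝ) * GTerm t n) =
        c * ((d n : ℝ) * ((n : ℝ) ^ (5 / 4 : ℝ))⁻¹) * (t ^ (-1 / 4 : ℝ) *
          Real.sin (4 * Real.pi * Real.sqrt ((n : ℝ) * t) - Real.pi / 4)) := fun t => by
      rw [GTerm]; ring
    simp_rw [e]
    rw [intervalIntegral.integral_const_mul, norm_mul, Real.norm_eq_abs, abs_of_nonneg (by positivity),
      Real.norm_eq_abs]
    gcongr
    exact abs_integral_rpow_mul_sin_le hn hx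

theorem integral_inv_sqrt {x : ℝ} (hx : 1 ≤ x) :
    ∫ t in (1 : ℝ)..x, (Real.sqrt t)⁻¹ = 2 * (Real.sqrt x - 1) := by
  have hpos : ∀ t ∈ uIcc 1 x, 0 < t := fun t ht => by
    rw [uIcc_of_le hx] at ht; linarith [ht.1]
  rw [intervalIntegral.integral_eq_sub_of_hasDerivAt (f := fun t => 2 * Real.sqrt t)]
  · rw [Real.sqrt_one]; ring
  · intro t ht
    refine ((Real.hasDerivAt_sqrt (hpos t ht).ne').const_mul 2).congr_deriv ?_
    field_simp
  · exact ContinuousOn.intervalIntegrable (ContinuousOn.inv₀ (by fun_prop) fun t ht =>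
      (Real.sqrt_pos.2 (hpos t ht)).ne')

theorem abs_integral_le_mul_sqrt {W : ℝ → ℝ} {C x : ℝ} (hx : 1 ≤ x)
    (hW : ∀ t ∈ Icc 1 x, |W t| ≤ C * (Real.sqrt t)⁻¹) (hC : 0 ≤ C) :
    |∫ t in (1 : ℝ)..x, W t| ≤ 2 * C * Real.sqrt x := by
  have h := intervalIntegral.norm_integral_le_of_norm_le (μ := volume) hx (f := W)
    (g := fun t => C * (Real.sqrt t)⁻¹)
    (Eventually.of_forall fun t ht => hW t ⟨ht.1.le, ht.2⟩) ?_
  · rw [intervalIntegral.integral_const_mul, integral_inv_sqrt hx] at h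
    refine h.trans ?_
    nlinarith
  · refine ContinuousOn.intervalIntegrable (continuousOn_const.mul
      (ContinuousOn.inv₀ (by fun_prop) fun t ht => ?_))
    rw [uIcc_of_le hx] at ht
    exact (Real.sqrt_pos.2 (by linarith [ht.1])).ne'

theorem mul_sqrt_mul_inv (C : ℝ) {t : ℝ} (ht : 0 < t) :
    C * Real.sqrt t * t⁻¹ = C * (Real.sqrt t)⁻¹ := by
  have h := Real.sqrt_pos.2 ht
  nth_rewrite 2 [← Real.sq_sqrt ht.le]
  field_simp

/-- Dividing x/4 + G + O(√x) by t, the three pieces integrate to x/4 + O(1), to O(√x) by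
oscillation, and to O(∫ t^(-1/2)) = O(√x). -/
theorem exists_abs_integral_primitive_mul_inv_sub_le : ∃ C : ℝ, 0 ≤ C ∧ ∀ x : ℝ, 1 ≤ x →
    |(∫ t in (1 : ℝ)..x, (∫ s in (1 : ℝ)..t, Delta s) * t⁻¹) - x / 4| ≤ C * Real.sqrt x := by
  obtain ⟨A, hA0, hA⟩ := exists_abs_integral_Delta_sub_le
  obtain ⟨B, hB0, hB⟩ := exists_abs_integral_G_mul_inv_le
  refine ⟨2 * A + B + 1, by positivity, fun x hx => ?_⟩
  have hu : uIcc 1 x = Icc 1 x := uIcc_of_le hx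
  have hinv : ContinuousOn (fun t : ℝ => t⁻¹) (uIcc 1 x) := by
    rw [hu]; exact continuousOn_inv_Icc le_rfl
  have i1 : IntervalIntegrable (fun t => G t * t⁻¹) volume 1 x :=
    (continuous_G.continuousOn.mul hinv).intervalIntegrable
  have i2 : IntervalIntegrable (fun t => ((∫ s in (1 : ℝ)..t, Delta s) - (t / 4 + G t)) * t⁻¹)
      volume 1 x := by
    refine ContinuousOn.intervalIntegrable (ContinuousOn.mul (Continuous.continuousOn ?_) hinv)
    exact continuous_integral_Delta.sub ((by fun_prop : Continuous fun t : ℝ => t / 4).add continuous_G)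
  have e : ∫ t in (1 : ℝ)..x, (∫ s in (1 : ℝ)..t, Delta s) * t⁻¹ =
      (x - 1) / 4 + (∫ t in (1 : ℝ)..x, G t * t⁻¹) +
        ∫ t in (1 : ℝ)..x, ((∫ s in (1 : ℝ)..t, Delta s) - (t / 4 + G t)) * t⁻¹ := by
    have hconst : ∫ _t in (1 : ℝ)..x, (1 / 4 : ℝ) = (x - 1) / 4 := by
      rw [intervalIntegral.integral_const, smul_eq_mul]; ring
    rw [← hconst, ← intervalIntegral.integral_add intervalIntegrable_const i1,
      ← intervalIntegral.integral_add (intervalIntegrable_const.add i1) i2]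
    refine intervalIntegral.integral_congr fun t ht => ?_
    rw [hu] at ht
    have ht0 : t ≠ 0 := by linarith [ht.1]
    field_simp
    ring
  have h1 := hB x hx
  have h2 := abs_integral_le_mul_sqrt hx
    (W := fun t => ((∫ s in (1 : ℝ)..t, Delta s) - (t / 4 + G t)) * t⁻¹) (C := A) (fun t ht => by
      have ht0 : 0 < t := by linarith [ht.1]
      rw [abs_mul, abs_of_pos (inv_pos.2 ht0), ← mul_sqrt_mul_inv A ht0]
      gcongr
      exact hA t ht.1) hA0
  have hs : 1 ≤ Real.sqrt x := Real.one_le_sqrt.2 hx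
  rw [e]
  rw [abs_le] at h1 h2 ⊢
  constructor <;> linarith [h1.1, h1.2, h2.1, h2.2]

/-! ### Error bounds and assembly. -/

theorem mainDeriv_nonneg {t : ℝ} (ht : 1 ≤ t) : 0 ≤ mainDeriv t := (log_add_pos ht).le

theorem mainDeriv_le {x t : ℝ} (hx : 2 ≤ x) (ht0 : 0 < t) (ht : t ≤ x) :
    mainDeriv t ≤ 3 * Real.log x := by
  have h1 := Real.log_le_log ht0 ht
  have h2 := Real.log_le_log two_pos hx
  have h3 := Real.log_two_gt_d9
  have h4 := Real.eulerMascheroniConstant_lt_two_thirds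
  rw [mainDeriv]
  linarith

theorem abs_integral_fractCubic_mul_le {x : ℝ} (hx : 2 ≤ x) :
    |∫ t in (1 : ℝ)..x, fractCubic t * (mainDeriv t * t⁻¹)| ≤ 3 * Real.log x ^ 2 := by
  have hx1 : 1 ≤ x := by linarith
  have hL : 0 ≤ Real.log x := Real.log_nonneg hx1
  have h := intervalIntegral.norm_integral_le_of_norm_le (μ := volume) hx1
    (f := fun t => fractCubic t * (mainDeriv t * t⁻¹)) (g := fun t => 3 * Real.log x * t⁻¹)
    (Eventually.of_forall fun t ht => ?_) ?_
  · rw [intervalIntegral.integral_const_mul, integral_inv_of_pos one_pos (by linarith), div_one] at h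
    refine h.trans (le_of_eq (by ring))
  · have ht0 : 0 < t := by linarith [ht.1]
    have h1 := mainDeriv_nonneg ht.1.le
    rw [Real.norm_eq_abs, abs_mul, abs_of_nonneg (by positivity : 0 ≤ mainDeriv t * t⁻¹)]
    calc _ ≤ 1 * (3 * Real.log x * t⁻¹) := by
          gcongr
          · exact abs_fractCubic_le t
          · exact mainDeriv_le hx ht0 ht.2
      _ = _ := one_mul _
  · refine ContinuousOn.intervalIntegrable ?_
    rw [uIcc_of_le hx1]
    exact continuousOn_const.mul (continuousOn_inv_Icc le_rfl)

theorem exists_abs_integral_psi_mul_sub_le : ∃ C : ℝ, 0 ≤ C ∧ ∀ x : ℝ, 2 ≤ x →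
    |2 * (∫ t in (1 : ℝ)..x, psi t * Delta t * mainDeriv t) +
      1 / 6 * ∫ t in (1 : ℝ)..x, mainDeriv t ^ 2| ≤ C * (Real.sqrt x * Real.log x) := by
  obtain ⟨C, hC0, hC⟩ := exists_abs_Delta_le
  refine ⟨9 * C + 60, by positivity, fun x hx => ?_⟩
  have hx1 : 1 ≤ x := by linarith
  have hx0 : 0 < x := by linarith
  have hs : 0 ≤ Real.sqrt x := Real.sqrt_nonneg x
  have hL1 : 1 / 2 ≤ Real.log x := by
    have := Real.log_le_log two_pos hx
    linarith [Real.log_two_gt_d9]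
  have hL : 0 ≤ Real.log x := by linarith
  have hm0 := mainDeriv_nonneg hx1
  have hm := mainDeriv_le hx hx0 le_rfl
  have h1 : |fractQuad x * Delta x * mainDeriv x| ≤ 1 / 8 * (C * Real.sqrt x) * (3 * Real.log x) := by
    rw [abs_mul, abs_mul, abs_of_nonneg hm0]
    gcongr
    · exact abs_fractQuad_le x
    · exact hC x hx1
  have h2 := abs_integral_le_mul_sqrt hx1 (W := fun t => fractQuad t * Delta t * t⁻¹) (C := C)
    (fun t ht => by
      have ht0 : 0 < t := by linarith [ht.1]
      rw [abs_mul, abs_mul, abs_of_pos (inv_pos.2 ht0), ← mul_sqrt_mul_inv C ht0]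
      refine mul_le_mul_of_nonneg_right ?_ (inv_nonneg.2 ht0.le)
      calc _ ≤ 1 * (C * Real.sqrt t) :=
            mul_le_mul ((abs_fractQuad_le t).trans (by norm_num)) (hC t ht.1) (abs_nonneg _) zero_le_one
        _ = _ := one_mul _) hC0
  have h3 : |fractCubic x * mainDeriv x ^ 2| ≤ 9 * Real.log x ^ 2 := by
    rw [abs_mul, abs_of_nonneg (by positivity : 0 ≤ mainDeriv x ^ 2)]
    calc _ ≤ 1 * (3 * Real.log x) ^ 2 := by
          gcongr
          exact abs_fractCubic_le x
      _ = _ := by ring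
  have h4 := abs_integral_fractCubic_mul_le hx
  -- The log² x terms produced by `fractCubic` are absorbed through log √x ≤ √x - 1.
  have h5 : Real.log x ^ 2 ≤ 2 * (Real.sqrt x * Real.log x) := by
    have h6 := Real.log_le_sub_one_of_pos (Real.sqrt_pos.2 hx0)
    rw [Real.log_sqrt hx0.le] at h6
    nlinarith
  have h7 : C * Real.sqrt x ≤ 2 * (C * (Real.sqrt x * Real.log x)) := by
    have := mul_nonneg hC0 hs
    nlinarith
  rw [integral_psi_mul_Delta_mul_mainDeriv hx1, integral_fractQuad_mul_mainDeriv_sq hx1]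
  rw [abs_le] at h1 h2 h3 h4 ⊢
  have h8 : 0 ≤ C * (Real.sqrt x * Real.log x) := by positivity
  constructor <;> nlinarith [h1.1, h1.2, h2.1, h2.2, h3.1, h3.2, h4.1, h4.2]

theorem exists_abs_integral_mul_mainDeriv_sub_le : ∃ C : ℝ, 0 ≤ C ∧ ∀ x : ℝ, 2 ≤ x →
    |(∫ t in (1 : ℝ)..x, Delta t * mainDeriv t) - (mainDeriv x * (x / 4 + G x) - x / 4)| ≤
      C * (Real.sqrt x * Real.log x) := by
  obtain ⟨A, hA0, hA⟩ := exists_abs_integral_Delta_sub_le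
  obtain ⟨B, hB0, hB⟩ := exists_abs_integral_primitive_mul_inv_sub_le
  refine ⟨3 * A + 2 * B, by positivity, fun x hx => ?_⟩
  have hx1 : 1 ≤ x := by linarith
  have hx0 : 0 < x := by linarith
  have hs : 0 ≤ Real.sqrt x := Real.sqrt_nonneg x
  have hL1 : 1 / 2 ≤ Real.log x := by
    have := Real.log_le_log two_pos hx
    linarith [Real.log_two_gt_d9]
  have hm0 := mainDeriv_nonneg hx1
  have hm := mainDeriv_le hx hx0 le_rfl
  have h1 : |mainDeriv x * ((∫ t in (1 : ℝ)..x, Delta t) - (x / 4 + G x))| ≤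
      3 * Real.log x * (A * Real.sqrt x) := by
    rw [abs_mul, abs_of_nonneg hm0]
    exact mul_le_mul hm (hA x hx1) (abs_nonneg _) (by linarith)
  have h2 := hB x hx1
  have h3 : B * Real.sqrt x ≤ 2 * (B * (Real.sqrt x * Real.log x)) := by
    have := mul_nonneg hB0 hs
    nlinarith
  rw [integral_Delta_mul_mainDeriv hx1]
  rw [abs_le] at h1 h2 ⊢
  constructor <;> nlinarith [h1.1, h1.2, h2.1, h2.2]

end DivisorMeanSquare

theorem theorem2 :
    (∀ x : ℝ, 2 ≤ x →
      IntervalIntegrable (fun t => DivisorMeanSquare.Delta t ^ 2) MeasureTheory.volume 1 x ∧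
      Summable (DivisorMeanSquare.GTerm x)) ∧
    ∃ C : ℝ, ∀ x : ℝ, 2 ≤ x →
      |(∑ n ∈ Finset.Icc 1 ⌊x⌋₊, DivisorMeanSquare.Delta (n : ℝ) ^ 2) -
          ((1 / 2 - DivisorMeanSquare.psi x) * DivisorMeanSquare.Delta x ^ 2
            + (∫ t in (1 : ℝ)..x, DivisorMeanSquare.Delta t ^ 2)
            + 1 / 6 * x * Real.log x ^ 2
            + (8 * Real.eulerMascheroniConstant - 1) / 12 * x * Real.log x
            + (8 * Real.eulerMascheroniConstant ^ 2
                - 2 * Real.eulerMascheroniConstant + 1) / 12 * x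
            + (Real.log x + 2 * Real.eulerMascheroniConstant) * DivisorMeanSquare.G x)|
        ≤ C * (Real.sqrt x * Real.log x) := by
  refine ⟨fun x hx => ⟨DivisorMeanSquare.intervalIntegrable_Delta_sq (by linarith),
    DivisorMeanSquare.summable_GTerm x⟩, ?_⟩
  obtain ⟨A, hA0, hA⟩ := DivisorMeanSquare.exists_abs_integral_mul_mainDeriv_sub_le
  obtain ⟨B, hB0, hB⟩ := DivisorMeanSquare.exists_abs_integral_psi_mul_sub_le
  -- The summand 2 absorbs the constant (2 - 4γ + 4γ²)/6 ≤ 1 left by the lower limit of ∫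
  -- `mainDeriv`², since √x log x ≥ 1/2.
  refine ⟨A + B + 2, fun x hx => ?_⟩
  have hx1 : 1 ≤ x := by linarith
  have h1 := hA x hx
  have h2 := hB x hx
  have hL : 1 / 2 ≤ Real.log x := by
    have := Real.log_le_log two_pos hx
    linarith [Real.log_two_gt_d9]
  have hs : 1 ≤ Real.sqrt x := Real.one_le_sqrt.2 hx1
  have hsL : 1 / 2 ≤ Real.sqrt x * Real.log x := by nlinarith
  rw [DivisorMeanSquare.integral_mainDeriv_sq hx1] at h2
  rw [DivisorMeanSquare.mainDeriv] at h1
  rw [DivisorMeanSquare.sum_Delta_sq_eq hx1]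
  have hγ0 := Real.one_half_lt_eulerMascheroniConstant
  have hγ1 := Real.eulerMascheroniConstant_lt_two_thirds
  have h3 : 0 ≤ 2 - 4 * Real.eulerMascheroniConstant + 4 * Real.eulerMascheroniConstant ^ 2 ∧
      2 - 4 * Real.eulerMascheroniConstant + 4 * Real.eulerMascheroniConstant ^ 2 ≤ 6 := by
    constructor <;> nlinarith
  rw [abs_le] at h1 h2 ⊢
  constructor <;> linarith [h1.1, h1.2, h2.1, h2.2, h3.1, h3.2]
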